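/- All random variables are discrete and have finite entropy. Let $G=(V,E)$ be a finite simple connected graph with $n=|V|$ vertices. Random variables $X_i$, $i\in V$, form a Markov random field (MRF) represented by $G$ if, for every partition $\{U,V_1,V_2\}$ of $V$ such that $V_1$ and $V_2$ are disconnected in $G\setminus U$, the families $X_{V_1}$ and $X_{V_2}$ are independent conditioning on $X_U$. Let $\tilde X_i$, $i\in V$, be set variables in general position, with universal set $\bigcup_{i\in V}\tilde X_i$, and write $\tilde X_A=\bigcup_{i\in A}\tilde X_i$. The I-Measure $\mu^*$ of $(X_i)_{i\in V}$ is the unique signed measure on the field generated by the $\tilde X_i$ with $\mu^*(\tilde X_A\cap\tilde X_B-\tilde X_C)=I(X_A;X_B\mid X_C)$ for all $A,B,C\subset V$ (so $\mu^*(\tilde X_A-\tilde X_C)=H(X_A\mid X_C)$). 1. For logarithms in any fixed base $b>1$, $\mu^*$ is nonnegative for all $X_i$, $i\in V$, forming an MRF represented by $G$ if and only if $G$ is a path (a single vertex counts as a path). 2. Suppose that a vertex $u$ has degree at least $3$, and let $v_1,v_2,v_3$ be any three distinct neighbours of $u$. Let $Z,T$ be independent fair bits, and put $X_{v_1}=Z$,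 $X_{v_2}=T$, $X_{v_3}=Z+T \bmod 2$, $X_u=(Z,T)$, and $X_i$ constant for all other $i$. Then $X_i$, $i\in V$, form an MRF represented by $G$, and, with logarithms in base $2$, $$\mu^*\Big(\tilde X_u\cap\tilde X_{v_1}\cap\tilde X_{v_2}\cap\tilde X_{v_3}-\bigcup_{i\ne u,v_1,v_2,v_3}\tilde X_i\Big)=-1 .$$ 3. If all vertices of $G$ have degree $2$, then $G$ is a cycle graph on $n\ge 3$ vertices. If $G$ is a cycle graph, with vertices $0,1,\dots,n-1$ in cyclic order, $n\ge3$, let $F$ be any finite field with at least $n-1$ elements. Then there exist distinct nonzero $\alpha_2,\dots,\alpha_{n-1}\in F$, and for every such choice the following holds. Let $Z,T$ be independent and uniform on $F$, and put $X_0=Z$, $X_1=T$, $X_i=Z+\alpha_iT$ for $2\le i\le n-1$. Then $X_i$, $i\in V$, form an MRF represented by $G$, and, with logarithms in base $|F|$, for every nonempty $W\subset V$, $$\mu^*\Big(\bigcap_{i\in W}\tilde X_i-\bigcup_{j\in V-W}\tilde X_j\Big)=\begin{cases}0&\text{if }1\le|W|\le n-2,\\ 1&\text{if }|W|=n-1,\\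 -(n-2)&\text{if }|W|=n.\end{cases}$$ In particular, $\mu^*$ is not always nonnegative in the cases 2 and 3. -/

import Mathlib

namespace MRF

open MeasureTheory

noncomputable section

/-! ### Discrete random variables, entropy, Markov random fields

The joint law of discrete random variables `X_i`, `i ∈ V`, is a probability mass function `p` on
the product `∀ i, X i` of their alphabets. -/

/-- The law of `X_S = (X_i, i ∈ S)`. -/
def marginal {V : Type*} {X : V → Type*} (p : PMF (∀ i, X i)) (S : Finset V) :
    PMF (∀ i : S, X i) :=
  p.map S.restrict

/-- The joint entropy `H(X_S)`, logarithms in base `b`. -/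
def entropy {V : Type*} {X : V → Type*} (b : ℝ) (p : PMF (∀ i, X i)) (S : Finset V) : ℝ :=
  ∑' x : ∀ i : S, X i, Real.negMulLog (marginal p S x).toReal / Real.log b

/-- `H(X_i) < ∞` for every `i` (all summands are nonnegative, so this is summability). -/
def FiniteEntropy {V : Type*} {X : V → Type*} (p : PMF (∀ i, X i)) : Prop :=
  ∀ i : V, Summable fun x : (∀ j : ({i} : Finset V), X j) =>
    Real.negMulLog (marginal p {i} x).toReal

/-- Shannon's conditional mutual information
`I(X_A; X_B | X_C) = H(X_A | X_C) + H(X_B | X_C) - H(X_A, X_B | X_C)`. For `A = B` it is the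
conditional entropy `H(X_A | X_C)`; for `C = ∅` it is unconditional. -/
def condMutualInfo {V : Type*} [DecidableEq V] {X : V → Type*} (b : ℝ) (p : PMF (∀ i, X i))
    (A B C : Finset V) : ℝ :=
  (entropy b p (A ∪ C) - entropy b p C) + (entropy b p (B ∪ C) - entropy b p C)
    - (entropy b p (A ∪ B ∪ C) - entropy b p C)

/-- `X_A` and `X_B` are independent conditioning on `X_C`. -/
def CondIndep {V : Type*} [DecidableEq V] {X : V → Type*} (p : PMF (∀ i, X i))
    (A B C : Finset V) : Prop :=
  ∀ x : ∀ i, X i,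
    marginal p (A ∪ B ∪ C) ((A ∪ B ∪ C).restrict x) * marginal p C (C.restrict x) =
      marginal p (A ∪ C) ((A ∪ C).restrict x) * marginal p (B ∪ C) ((B ∪ C).restrict x)

/-- `p` forms a Markov random field represented by `G` (global Markov property): whenever
`{U, V₁, V₂}` is a partition of the vertex set such that `V₁` and `V₂` are disconnected in
`G \ U`, `X_{V₁}` and `X_{V₂}` are independent conditioning on `X_U`. -/
def IsMRF {V : Type*} [Fintype V] [DecidableEq V] (G : SimpleGraph V) {X : V → Type*}
    (p : PMF (∀ i, X i)) : Prop :=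
  ∀ U V₁ V₂ : Finset V, Disjoint U V₁ → Disjoint U V₂ → Disjoint V₁ V₂ →
    U ∪ V₁ ∪ V₂ = Finset.univ →
    (∀ a b : {v : V // v ∉ U}, (a : V) ∈ V₁ → (b : V) ∈ V₂ →
      ¬ (G.induce {v : V | v ∉ U}).Reachable a b) →
    CondIndep p V₁ V₂ U

/-! ### The I-Measure -/

/-- The universal set `Ω_V = ⋃ i, X̃_i`, with one point for each of the `2 ^ n - 1` nonempty
atoms: the point `W` is the atom in which exactly the `X̃_i` with `i ∈ W` are not complemented. -/
def InfoSpace (V : Type*) : Type _ := {W : Finset V // W.Nonempty}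

/-- The set variable `X̃_i`. -/
def setVar {V : Type*} (i : V) : Set (InfoSpace V) := {W | i ∈ W.1}

/-- `X̃_S = ⋃ i ∈ S, X̃_i`. -/
def setVarUnion {V : Type*} (S : Finset V) : Set (InfoSpace V) := ⋃ i ∈ S, setVar i

/-- The field `F_V` generated by the set variables. -/
instance instMeasurableSpaceInfoSpace (V : Type*) : MeasurableSpace (InfoSpace V) :=
  MeasurableSpace.generateFrom (Set.range setVar)

/-- The atom `⋂ i ∈ W, X̃_i - ⋃ j ∉ W, X̃_j`. -/
def atom {V : Type*} (W : Finset V) : Set (InfoSpace V) :=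
  (⋂ i ∈ W, setVar i) \ (⋃ j ∉ W, setVar j)

/-- A signed measure on `F_V` is consistent with all of Shannon's information measures under the
substitution of `∪` for `,`, of `∩` for `;` and of set difference for `|`. -/
def IsIMeasure {V : Type*} [DecidableEq V] {X : V → Type*} (b : ℝ) (p : PMF (∀ i, X i))
    (μ : SignedMeasure (InfoSpace V)) : Prop :=
  ∀ A B C : Finset V,
    μ ((setVarUnion A ∩ setVarUnion B) \ setVarUnion C) = condMutualInfo b p A B C

instance instFiniteInfoSpace (V : Type*) [Finite V] : Finite (InfoSpace V) :=
  inferInstanceAs (Finite {W : Finset V // W.Nonempty})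

theorem measurableSet_setVar {V : Type*} (i : V) : MeasurableSet (setVar i) :=
  MeasurableSpace.measurableSet_generateFrom ⟨i, rfl⟩

theorem mem_setVarUnion {V : Type*} {S : Finset V} {w : InfoSpace V} :
    w ∈ setVarUnion S ↔ ∃ i ∈ S, i ∈ w.1 := by
  simp [setVarUnion, setVar]

theorem atom_eq_singleton {V : Type*} (w : InfoSpace V) : atom w.1 = {w} := by
  ext z
  simp only [atom, setVar, Set.mem_sdiff, Set.mem_iInter, Set.mem_ofPred_eq, Set.mem_iUnion,
    Set.mem_singleton_iff, not_exists]
  constructor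
  · rintro ⟨h1, h2⟩
    apply Subtype.ext
    ext i
    exact ⟨fun hi => by_contra fun hn => h2 i hn hi, h1 i⟩
  · rintro rfl
    exact ⟨fun i hi => hi, fun i hi h => hi h⟩

theorem measurableSet_infoSpace {V : Type*} [Finite V] (S : Set (InfoSpace V)) :
    MeasurableSet S := by
  have hs : ∀ w : InfoSpace V, MeasurableSet ({w} : Set (InfoSpace V)) := by
    intro w
    rw [← atom_eq_singleton]
    exact (MeasurableSet.iInter fun i => MeasurableSet.iInter fun _ => measurableSet_setVar i).diff
      (MeasurableSet.iUnion fun i => MeasurableSet.iUnion fun _ => measurableSet_setVar i)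
  rw [← Set.biUnion_of_singleton S]
  exact S.toFinite.measurableSet_biUnion fun w _ => hs w

open Classical in
theorem signedMeasure_apply_eq_sum {V : Type*} [Finite V] [Fintype (InfoSpace V)]
    (μ : SignedMeasure (InfoSpace V)) (S : Set (InfoSpace V)) :
    μ S = ∑ w : InfoSpace V, if w ∈ S then μ {w} else 0 := by
  have h := μ.of_biUnion_finset (s := S.toFinite.toFinset) (f := fun w => ({w} : Set (InfoSpace V)))
    (by intro a _ c _ hac; simpa using hac) (fun w _ => measurableSet_infoSpace _)
  rw [show (⋃ w ∈ S.toFinite.toFinset, ({w} : Set (InfoSpace V))) = S by ext; simp] at h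
  rw [h, ← Finset.sum_filter]
  apply Finset.sum_congr _ fun _ _ => rfl
  ext; simp

theorem signedMeasure_sum_apply {V ι : Type*} (s : Finset ι)
    (μ : ι → SignedMeasure (InfoSpace V)) (S : Set (InfoSpace V)) :
    (∑ i ∈ s, μ i) S = ∑ i ∈ s, μ i S := by
  classical
  induction s using Finset.induction_on with
  | empty => simp
  | insert a t ha ih => rw [Finset.sum_insert ha, Finset.sum_insert ha, add_apply, ih]

theorem exists_sum_powerset {V : Type*} (g : Finset V → ℝ) :
    ∃ f : Finset V → ℝ, ∀ S, ∑ W ∈ S.powerset, f W = g S := by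
  classical
  let f : Finset V → ℝ := Finset.strongInduction
    (fun S ih => g S - ∑ W ∈ S.ssubsets.attach, ih W.1 (Finset.mem_ssubsets.1 W.2))
  refine ⟨f, fun S => ?_⟩
  have hf : f S = g S - ∑ W ∈ S.ssubsets, f W := by
    rw [← Finset.sum_attach]
    exact Finset.strongInduction_eq _ S
  rw [← Finset.insert_erase (Finset.mem_powerset_self S), Finset.sum_insert (by simp), hf]
  simp [Finset.ssubsets]

theorem entropy_empty {V : Type*} {X : V → Type*} (b : ℝ) (p : PMF (∀ i, X i)) :
    entropy b p ∅ = 0 := by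
  have h : ∀ x, marginal p ∅ x = 1 := by
    intro x
    have := (marginal p (∅ : Finset V)).tsum_coe
    rwa [tsum_eq_single x (fun y hy => absurd (Subsingleton.elim y x) hy)] at this
  simp [entropy, h]

theorem existsUnique_isIMeasure {V : Type*} [Fintype V] [DecidableEq V] {X : V → Type*} (b : ℝ)
    (p : PMF (∀ i, X i)) : ∃! μ : SignedMeasure (InfoSpace V), IsIMeasure b p μ := by
  classical
  have : Fintype (InfoSpace V) := Fintype.ofFinite _
  have hsum : ∀ (F : Finset V → ℝ), F ∅ = 0 → ∀ S : Finset V,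
      ∑ w : InfoSpace V, (if w.1 ⊆ S then F w.1 else 0) = ∑ W ∈ S.powerset, F W := by
    intro F hF S
    rw [← Finset.sum_filter]
    have : ∑ W ∈ S.powerset, F W = ∑ W ∈ S.powerset.filter (fun W => W.Nonempty), F W := by
      rw [Finset.sum_filter]
      apply Finset.sum_congr rfl
      intro W _
      by_cases h : W.Nonempty
      · simp [h]
      · simp [Finset.not_nonempty_iff_eq_empty.1 h, hF]
    rw [this]
    refine Finset.sum_bij (fun w _ => w.1) ?_ ?_ ?_ ?_
    · intro w hw
      simp only [Finset.mem_filter, Finset.mem_univ, true_and] at hw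
      simp only [Finset.mem_filter, Finset.mem_powerset]
      exact ⟨hw, w.2⟩
    · intro w _ z _ h
      exact Subtype.ext h
    · intro W hW
      simp only [Finset.mem_filter, Finset.mem_powerset] at hW
      exact ⟨⟨W, hW.2⟩, Finset.mem_filter.2 ⟨Finset.mem_univ _, hW.1⟩, rfl⟩
    · intros; rfl
  have hnot : ∀ (A : Finset V) (w : InfoSpace V), w ∈ setVarUnion A ↔ ¬ w.1 ⊆ Aᶜ := by
    intro A w
    rw [mem_setVarUnion, Finset.not_subset]
    constructor
    · rintro ⟨i, h1, h2⟩; exact ⟨i, h2, by simpa using h1⟩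
    · rintro ⟨i, h1, h2⟩; exact ⟨i, by simpa using h2, h1⟩
  obtain ⟨f, hf⟩ := exists_sum_powerset
    (fun S : Finset V => entropy b p Finset.univ - entropy b p Sᶜ)
  have hf0 : f ∅ = 0 := by simpa using hf ∅
  have hall : ∑ w : InfoSpace V, f w.1 = entropy b p Finset.univ := by
    have := hsum f hf0 Finset.univ
    rw [hf] at this
    simpa [entropy_empty] using this
  have hH : ∀ A : Finset V,
      ∑ w : InfoSpace V, (if w ∈ setVarUnion A then f w.1 else 0) = entropy b p A := by
    intro A
    have h1 := hsum f hf0 Aᶜ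
    rw [hf, compl_compl] at h1
    have h2 : ∑ w : InfoSpace V, (if w ∈ setVarUnion A then f w.1 else 0) =
        ∑ w : InfoSpace V, f w.1 - ∑ w : InfoSpace V, (if w.1 ⊆ Aᶜ then f w.1 else 0) := by
      rw [← Finset.sum_sub_distrib]
      apply Finset.sum_congr rfl
      intro w _
      rw [hnot]
      by_cases h : w.1 ⊆ Aᶜ <;> simp [h]
    rw [h2, h1, hall]; ring
  refine ⟨∑ w : InfoSpace V, f w.1 • (Measure.dirac w).toSignedMeasure, ?_, ?_⟩
  · intro A B C
    have hval : ∀ S : Set (InfoSpace V),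
        (∑ w : InfoSpace V, f w.1 • (Measure.dirac w).toSignedMeasure) S =
          ∑ w : InfoSpace V, if w ∈ S then f w.1 else 0 := by
      intro S
      rw [signedMeasure_sum_apply]
      apply Finset.sum_congr rfl
      intro w _
      rw [FunLike.coe_smul, Pi.smul_apply,
        Measure.toSignedMeasure_apply_measurable (measurableSet_infoSpace S), measureReal_def,
        Measure.dirac_apply' _ (measurableSet_infoSpace S)]
      by_cases h : w ∈ S <;> simp [h]
    rw [hval, condMutualInfo, ← hH, ← hH, ← hH, ← hH, ← Finset.sum_sub_distrib,
      ← Finset.sum_sub_distrib, ← Finset.sum_sub_distrib, ← Finset.sum_add_distrib,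
      ← Finset.sum_sub_distrib]
    apply Finset.sum_congr rfl
    intro w _
    have hu : ∀ P Q : Finset V, w ∈ setVarUnion (P ∪ Q) ↔ w ∈ setVarUnion P ∨ w ∈ setVarUnion Q := by
      intro P Q
      simp only [mem_setVarUnion, Finset.mem_union, or_and_right, exists_or]
    simp only [hu, Set.mem_sdiff, Set.mem_inter_iff]
    by_cases h1 : w ∈ setVarUnion A <;> by_cases h2 : w ∈ setVarUnion B <;>
      by_cases h3 : w ∈ setVarUnion C <;> simp [h1, h2, h3]
  · intro ν hν
    have hνH : ∀ A : Finset V, ν (setVarUnion A) = entropy b p A := by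
      intro A
      have := hν A A ∅
      simpa [condMutualInfo, entropy_empty, setVarUnion] using this
    set F : Finset V → ℝ := fun W => if h : W.Nonempty then ν {(⟨W, h⟩ : InfoSpace V)} else 0
      with hFdef
    have hF0 : F ∅ = 0 := by simp [hFdef]
    have hFw : ∀ w : InfoSpace V, F w.1 = ν {w} := by
      intro w
      simp only [hFdef, dif_pos w.2]
      rfl
    have hFH : ∀ A : Finset V,
        ∑ w : InfoSpace V, (if w ∈ setVarUnion A then F w.1 else 0) = entropy b p A := by
      intro A
      rw [← hνH, signedMeasure_apply_eq_sum]
      simp only [hFw]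
    have hFS : ∀ S : Finset V, ∑ W ∈ S.powerset, F W = ∑ W ∈ S.powerset, f W := by
      intro S
      rw [← hsum F hF0, ← hsum f hf0]
      have key : ∀ k : Finset V → ℝ, ∑ w : InfoSpace V, (if w.1 ⊆ S then k w.1 else 0) =
          ∑ w : InfoSpace V, (if w ∈ setVarUnion (Finset.univ : Finset V) then k w.1 else 0) -
          ∑ w : InfoSpace V, (if w ∈ setVarUnion Sᶜ then k w.1 else 0) := by
        intro k
        rw [← Finset.sum_sub_distrib]
        apply Finset.sum_congr rfl
        intro w _
        have hw : ¬ w.1 ⊆ (Finset.univ : Finset V)ᶜ := by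
          simpa [Finset.subset_empty] using w.2.ne_empty
        rw [hnot, hnot, compl_compl, if_pos hw]
        by_cases h : w.1 ⊆ S <;> simp [h]
      rw [key F, key f, hFH, hFH, hH, hH]
    have hFf : ∀ W : Finset V, F W = f W := by
      intro W
      induction W using Finset.strongInduction with
      | H W ih =>
        have h := hFS W
        rw [← Finset.insert_erase (Finset.mem_powerset_self W), Finset.sum_insert (by simp),
          Finset.sum_insert (by simp)] at h
        have h2 : ∑ x ∈ W.powerset.erase W, F x = ∑ x ∈ W.powerset.erase W, f x :=
          Finset.sum_congr rfl fun x hx => ih x (Finset.mem_ssubsets.1 hx)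
        linarith
    ext S _
    rw [signedMeasure_apply_eq_sum, signedMeasure_sum_apply]
    apply Finset.sum_congr rfl
    intro w _
    rw [FunLike.coe_smul, Pi.smul_apply,
      Measure.toSignedMeasure_apply_measurable (measurableSet_infoSpace S), measureReal_def,
      Measure.dirac_apply' _ (measurableSet_infoSpace S), ← hFw, hFf]
    by_cases h : w ∈ S <;> simp [h]

/-- The I-Measure `μ*` of `p`: the unique signed measure on `F_V` that is consistent with all of
Shannon's information measures (logarithms in base `b`). -/
def iMeasure {V : Type*} [Fintype V] [DecidableEq V] {X : V → Type*} (b : ℝ)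
    (p : PMF (∀ i, X i)) : SignedMeasure (InfoSpace V) :=
  (existsUnique_isIMeasure b p).choose

/-! ### Graphs and the two constructions -/

/-- `G` is a path. -/
def IsPathGraph {V : Type*} (G : SimpleGraph V) : Prop :=
  ∃ n : ℕ, Nonempty (G ≃g SimpleGraph.pathGraph n)

/-- The joint law of `X_{v 0} = Z`, `X_{v 1} = T`, `X_{v 2} = Z + T mod 2`, `X_u = (Z, T)` and all
other `X_i` constant, where `Z`, `T` are independent fair bits. A bit `a` is coded as `(a, 0)`, so
that all variables have the alphabet `ZMod 2 × ZMod 2`. -/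
def xorLaw {V : Type*} [DecidableEq V] (u : V) (v : Fin 3 → V) :
    PMF (V → ZMod 2 × ZMod 2) :=
  (PMF.uniformOfFintype (ZMod 2 × ZMod 2)).map fun ω i =>
    if i = v 0 then (ω.1, 0)
    else if i = v 1 then (ω.2, 0)
    else if i = v 2 then (ω.1 + ω.2, 0)
    else if i = u then ω
    else 0

/-- The joint law of `X_0 = Z`, `X_1 = T`, `X_k = Z + α_k T` for `k = 2, …, n - 1`, where `Z`, `T`
are independent and uniform on the finite field `F`, and the vertices are numbered by `e`. -/
def fieldLaw {V : Type*} {n : ℕ} (e : V → Fin n) (F : Type*) [Field F] [Fintype F]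
    (α : Fin n → F) : PMF (V → F) :=
  (PMF.uniformOfFintype (F × F)).map fun ω i =>
    if (e i : ℕ) = 0 then ω.1
    else if (e i : ℕ) = 1 then ω.2
    else ω.1 + α (e i) * ω.2

end

end MRF

/-! ### Connected graphs of maximum degree two -/

namespace MRF

open SimpleGraph

/-! Let `G` be a path and `W` a set of vertices. Suppose first that `W` misses a vertex `k` lying
between two of its members. Then the parts of `W` on either side of `k` are separated by the
complement of `W`, so their conditional mutual information is zero. The set carrying this quantity
consists of the atom `W` and of smaller atoms with the same gap, so by induction the atom `W` is
null. If instead `W` has no gap and has ends `a` and `c`, the set carrying `I(X_a; X_c | X_{Wᶜ})`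
consists of the atom `W` and of atoms with gaps, which are null. Hence the atom has this value,
which is nonnegative. The lemmas are `iMeasure_singleton_eq_zero` and `condMutualInfo_nonneg`, the
latter for countable alphabets with finite entropy.

Conversely, a connected graph that is not a path has a vertex of degree at least 3 or is a cycle
(`exists_iso_pathGraph`, `exists_iso_cycleGraph`), and in both cases an explicit MRF has a negative
atom. For the XOR law the atom comes from inclusion-exclusion: two independent bits become dependent
once their sum is known. For the field law any two variables determine all, so `H(X_S) = min(|S|,
2)`, and Möbius inversion over subsets yields every atom. A change of base multiplies the I-Measure
by a positive constant, so a negative atom in one base refutes nonnegativity in all. -/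

theorem exists_adj_dist_eq {V : Type*} {G : SimpleGraph V} (hG : G.Connected) {v x : V} {d : ℕ}
    (h : G.dist v x = d + 1) : ∃ z, G.Adj z x ∧ G.dist v z = d := by
  obtain ⟨p, hp⟩ := hG.exists_walk_length_eq_dist x v
  rw [dist_comm, h] at hp
  cases p with
  | nil => simp at hp
  | @cons _ z _ hxz q =>
    refine ⟨z, hxz.symm, ?_⟩
    have h1 : G.dist v z ≤ d := by
      rw [dist_comm]
      refine (dist_le q).trans ?_
      simpa using hp.le
    have h2 : G.dist v x ≤ G.dist v z + G.dist z x := hG.dist_triangle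
    rw [dist_eq_one_iff_adj.2 hxz.symm] at h2
    omega

/-- A vertex of degree at most `1` in a connected graph of maximum degree `2` is an end of a path:
the distance to it is injective. -/
theorem dist_injective {V : Type*} [Fintype V] {G : SimpleGraph V} [DecidableRel G.Adj]
    (hG : G.Connected) (hdeg : ∀ v, G.degree v ≤ 2) {v : V} (hv : G.degree v ≤ 1) :
    Function.Injective (G.dist v) := by
  classical
  suffices h : ∀ d x y, G.dist v x = d → G.dist v y = d → x = y from
    fun x y hxy => h _ x y rfl hxy.symm
  intro d
  induction d with
  | zero =>
    intro x y hx hy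
    rw [hG.dist_eq_zero_iff] at hx hy
    rw [← hx, ← hy]
  | succ d ih =>
    intro x y hx hy
    by_contra hne
    obtain ⟨z, hzx, hz⟩ := exists_adj_dist_eq hG hx
    obtain ⟨z', hzy, hz'⟩ := exists_adj_dist_eq hG hy
    obtain rfl := ih z z' hz hz'
    cases d with
    | zero =>
      -- Here `z = v`, and two neighbours contradict degree at most 1.
      obtain rfl := hG.dist_eq_zero_iff.1 hz
      have : ({x, y} : Finset V) ⊆ G.neighborFinset v := by
        intro w hw
        simp only [Finset.mem_insert, Finset.mem_singleton] at hw
        rw [mem_neighborFinset]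
        rcases hw with rfl | rfl <;> assumption
      have := Finset.card_le_card this
      rw [Finset.card_pair hne, card_neighborFinset_eq_degree] at this
      omega
    | succ d =>
      -- A vertex `t` one step closer to `v` is a third neighbour of `z`.
      obtain ⟨t, htz, ht⟩ := exists_adj_dist_eq hG hz
      have : ({t, x, y} : Finset V) ⊆ G.neighborFinset z := by
        intro w hw
        simp only [Finset.mem_insert, Finset.mem_singleton] at hw
        rw [mem_neighborFinset]
        rcases hw with rfl | rfl | rfl
        · exact htz.symm
        · assumption
        · assumption
      have := Finset.card_le_card this
      have htx : t ≠ x := by rintro rfl; omega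
      have hty : t ≠ y := by rintro rfl; omega
      rw [Finset.card_insert_of_notMem (by simp [htx, hty]), Finset.card_pair hne,
        card_neighborFinset_eq_degree] at this
      have := hdeg z
      omega

/-- The distance from `v` is itself the isomorphism. It is injective into `Fin (card V)`, hence
bijective, and along an edge it changes by exactly one. -/
theorem exists_iso_pathGraph {V : Type*} [Fintype V] {G : SimpleGraph V} [DecidableRel G.Adj]
    (hG : G.Connected) (hdeg : ∀ v, G.degree v ≤ 2) {v : V} (hv : G.degree v ≤ 1) :
    ∃ e : G ≃g pathGraph (Fintype.card V), (e v : ℕ) = 0 := by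
  have hinj := dist_injective hG hdeg hv
  have hlt : ∀ x, G.dist v x < Fintype.card V := by
    intro x
    obtain ⟨p, hp, hl⟩ := hG.exists_path_of_dist v x
    exact hl ▸ hp.length_lt
  let f : V → Fin (Fintype.card V) := fun x => ⟨G.dist v x, hlt x⟩
  have hf : Function.Bijective f := by
    rw [Fintype.bijective_iff_injective_and_card]
    exact ⟨fun x y h => hinj (Fin.ext_iff.1 h), by simp⟩
  have key : ∀ x y, G.dist v x + 1 = G.dist v y → G.Adj x y := by
    intro x y h
    obtain ⟨z, hz, hd⟩ := exists_adj_dist_eq hG h.symm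
    obtain rfl := hinj hd
    exact hz
  refine ⟨⟨Equiv.ofBijective f hf, ?_⟩, ?_⟩
  · intro x y
    simp only [Equiv.ofBijective_apply, pathGraph_adj, f]
    constructor
    · rintro (h | h)
      · exact key _ _ h
      · exact (key _ _ h).symm
    · intro h
      have h1 := h.diff_dist_adj (u := v)
      have h2 : G.dist v x ≠ G.dist v y := fun h' => h.ne (hinj h')
      omega
  · simp [f]

theorem degree_deleteEdges_le_one {V : Type*} [Fintype V] [DecidableEq V] {G : SimpleGraph V}
    [DecidableRel G.Adj] {a b : V} {q : Sym2 V} [DecidableRel (G.deleteEdges {q}).Adj]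
    (hq : q = s(a, b)) (hab : G.Adj a b) (h : G.degree a = 2) :
    (G.deleteEdges {q}).degree a ≤ 1 := by
  have : (G.deleteEdges {q}).neighborFinset a ⊆ (G.neighborFinset a).erase b := by
    intro w hw
    rw [mem_neighborFinset, deleteEdges_adj] at hw
    rw [Finset.mem_erase, mem_neighborFinset]
    refine ⟨?_, hw.1⟩
    rintro rfl
    exact hw.2 hq.symm
  have := Finset.card_le_card this
  rwa [Finset.card_erase_of_mem (by simpa using hab), card_neighborFinset_eq_degree,
    card_neighborFinset_eq_degree, h] at this

theorem cycleGraph_adj_iff_val {n : ℕ} (hn : 3 ≤ n) {i j : Fin n} :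
    (cycleGraph n).Adj i j ↔ ((i : ℕ) + 1 = j ∨ (j : ℕ) + 1 = i) ∨
      ((i : ℕ) = 0 ∧ (j : ℕ) = n - 1 ∨ (i : ℕ) = n - 1 ∧ (j : ℕ) = 0) := by
  have hs : ∀ i j : Fin n, (i - j).val = 1 ↔
      (j : ℕ) + 1 = i ∨ (i : ℕ) = 0 ∧ (j : ℕ) = n - 1 := by
    intro i j
    have hi := i.2
    have hj := j.2
    rw [Fin.val_sub]
    rcases le_or_gt (j : ℕ) i with h | h
    · rw [show n - (j : ℕ) + i = i - j + n by omega, Nat.add_mod_right,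
        Nat.mod_eq_of_lt (by omega)]
      omega
    · rw [Nat.mod_eq_of_lt (by omega)]
      omega
  rw [cycleGraph_adj', hs, hs]
  omega

/-- An edge `ab` of a 2-regular graph is not a bridge. Deleting it leaves a connected graph in which
`a` and `b` have degree at most 1, that is, a path from `a` to `b`; restoring the edge closes it up.
-/
theorem exists_iso_cycleGraph {V : Type*} [Fintype V] {G : SimpleGraph V} [DecidableRel G.Adj]
    (hG : G.Connected) (hdeg : ∀ v, G.degree v = 2) :
    ∃ n : ℕ, 3 ≤ n ∧ Nonempty (G ≃g cycleGraph n) := by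
  classical
  obtain ⟨a⟩ := hG.nonempty
  obtain ⟨b, hab⟩ : ∃ b, G.Adj a b := by
    rw [← degree_pos_iff_exists_adj, hdeg]; norm_num
  have hcard : 3 ≤ Fintype.card V := by
    have := G.degree_lt_card_verts a
    rw [hdeg] at this
    omega
  have hcyc : G.IsCycles := by
    intro v _
    rw [← hdeg v, ← card_neighborSet_eq_degree, Set.ncard_eq_toFinset_card', Set.toFinset_card]
  set G' := G.deleteEdges {s(a, b)} with hG'
  have hconn : G'.Connected := by
    refine hG.connected_delete_edge_of_not_isBridge ?_
    rw [isBridge_iff]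
    simp [hcyc.reachable_deleteEdges hab]
  have ha : G'.degree a ≤ 1 := degree_deleteEdges_le_one rfl hab (hdeg a)
  have hb : G'.degree b ≤ 1 :=
    degree_deleteEdges_le_one Sym2.eq_swap hab.symm (hdeg b)
  obtain ⟨e, he⟩ := exists_iso_pathGraph hconn
    (fun v => (degree_le_of_le (deleteEdges_le _)).trans (hdeg v).le) ha
  -- An inner vertex of the path would have two neighbours, but `b` has at most one left.
  have heb : (e b : ℕ) = Fintype.card V - 1 := by
    by_contra hne
    have h0 : (e b : ℕ) ≠ 0 := by
      intro h
      rw [← he] at h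
      exact hab.ne' (e.injective (Fin.ext h))
    have hlt := (e b).2
    let i : Fin (Fintype.card V) := ⟨e b - 1, by omega⟩
    let j : Fin (Fintype.card V) := ⟨e b + 1, by omega⟩
    have hij : e.symm i ≠ e.symm j := by
      intro h
      have := Fin.ext_iff.1 (e.symm.injective h)
      simp only [i, j] at this
      omega
    have hsub : ({e.symm i, e.symm j} : Finset V) ⊆ G'.neighborFinset b := by
      intro w hw
      simp only [Finset.mem_insert, Finset.mem_singleton] at hw
      rw [mem_neighborFinset, ← e.map_adj_iff, pathGraph_adj]
      rcases hw with rfl | rfl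
      · right; simp only [RelIso.apply_symm_apply, i]; omega
      · left; simp only [RelIso.apply_symm_apply, j]
    have := Finset.card_le_card hsub
    rw [Finset.card_pair hij, card_neighborFinset_eq_degree] at this
    omega
  refine ⟨_, hcard, ⟨⟨e.toEquiv, ?_⟩⟩⟩
  intro x y
  have hxa : x = a ↔ (e x : ℕ) = 0 := by rw [← he, ← Fin.ext_iff, e.injective.eq_iff]
  have hya : y = a ↔ (e y : ℕ) = 0 := by rw [← he, ← Fin.ext_iff, e.injective.eq_iff]
  have hxb : x = b ↔ (e x : ℕ) = Fintype.card V - 1 := by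
    rw [← heb, ← Fin.ext_iff, e.injective.eq_iff]
  have hyb : y = b ↔ (e y : ℕ) = Fintype.card V - 1 := by
    rw [← heb, ← Fin.ext_iff, e.injective.eq_iff]
  have hadj : G.Adj x y ↔ G'.Adj x y ∨ s(x, y) = s(a, b) := by
    rw [hG', deleteEdges_adj, Set.mem_singleton_iff]
    constructor
    · intro h
      by_cases h' : s(x, y) = s(a, b)
      · exact Or.inr h'
      · exact Or.inl ⟨h, h'⟩
    · rintro (h | h)
      · exact h.1
      · rwa [← mem_edgeSet, h, mem_edgeSet]
  rw [hadj, ← e.map_adj_iff, pathGraph_adj, Sym2.eq_iff, hxa, hyb, hxb, hya]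
  exact cycleGraph_adj_iff_val hcard

end MRF

/-! ### Surprisal and entropy of functions on a discrete probability space -/

namespace MRF

open scoped ENNReal

section Discrete

variable {Ω α β γ : Type*} (p : PMF Ω)

theorem tsum_map_mul (f : Ω → α) (φ : α → ℝ≥0∞) :
    ∑' a, p.map f a * φ a = ∑' ω, p ω * φ (f ω) := by
  classical
  simp_rw [PMF.map_apply, ← ENNReal.tsum_mul_right]
  rw [ENNReal.tsum_comm]
  refine tsum_congr fun ω => ?_
  rw [tsum_eq_single (f ω) (fun a ha => by simp [ha])]
  simp

/-- Both sides are the probability of the same event, so pairs of restrictions and restrictions to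
unions are interchangeable. -/
theorem map_apply_congr {f : Ω → α} {g : Ω → β} {a : α} {c : β}
    (h : ∀ ω, a = f ω ↔ c = g ω) : p.map f a = p.map g c := by
  classical
  simp only [PMF.map_apply]
  refine tsum_congr fun ω => ?_
  simp only [h ω]

theorem le_map_apply (f : Ω → α) (ω : Ω) : p ω ≤ p.map f (f ω) := by
  classical
  rw [PMF.map_apply]
  refine le_trans (le_of_eq ?_) (ENNReal.le_tsum ω)
  simp

theorem toReal_map_pos (f : Ω → α) {ω : Ω} (h : p ω ≠ 0) : 0 < (p.map f (f ω)).toReal :=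
  ENNReal.toReal_pos (fun h0 => h (le_antisymm (h0 ▸ le_map_apply p f ω) zero_le))
    (PMF.apply_ne_top _ _)

theorem toReal_apply_le_one (q : PMF α) (a : α) : (q a).toReal ≤ 1 := by
  simpa using ENNReal.toReal_mono ENNReal.one_ne_top (q.coe_le_one a)

theorem neg_log_nonneg (q : PMF α) (a : α) : 0 ≤ -Real.log (q a).toReal :=
  neg_nonneg.2 (Real.log_nonpos ENNReal.toReal_nonneg (toReal_apply_le_one q a))

/-- The entropy of `f` in nats, with values in `[0, ∞]`, as the expected surprisal. -/
noncomputable def eentropy (f : Ω → α) : ℝ≥0∞ :=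
  ∑' ω, p ω * ENNReal.ofReal (-Real.log (p.map f (f ω)).toReal)

theorem eentropy_eq_tsum_negMulLog (f : Ω → α) :
    eentropy p f = ∑' a, ENNReal.ofReal (Real.negMulLog (p.map f a).toReal) := by
  rw [eentropy, ← tsum_map_mul p f fun a => ENNReal.ofReal (-Real.log (p.map f a).toReal)]
  refine tsum_congr fun a => ?_
  rw [Real.negMulLog, neg_mul_comm, ENNReal.ofReal_mul ENNReal.toReal_nonneg,
    ENNReal.ofReal_toReal (PMF.apply_ne_top _ _)]

theorem tsum_negMulLog_map (f : Ω → α) :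
    ∑' a, Real.negMulLog (p.map f a).toReal =
      ∑' ω, (p ω).toReal * -Real.log (p.map f (f ω)).toReal := by
  have h := congrArg ENNReal.toReal (eentropy_eq_tsum_negMulLog p f)
  rw [eentropy, ENNReal.tsum_toReal_eq (fun ω =>
    ENNReal.mul_ne_top (PMF.apply_ne_top _ _) ENNReal.ofReal_ne_top),
    ENNReal.tsum_toReal_eq (fun _ => ENNReal.ofReal_ne_top)] at h
  simp only [ENNReal.toReal_mul, ENNReal.toReal_ofReal (neg_log_nonneg _ _),
    ENNReal.toReal_ofReal (Real.negMulLog_nonneg ENNReal.toReal_nonneg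
      (toReal_apply_le_one _ _))] at h
  exact h.symm

theorem summable_surprisal {f : Ω → α} (h : eentropy p f ≠ ∞) :
    Summable fun ω => (p ω).toReal * -Real.log (p.map f (f ω)).toReal := by
  have := ENNReal.summable_toReal h
  simpa only [ENNReal.toReal_mul, ENNReal.toReal_ofReal (neg_log_nonneg _ _)] using this

theorem tsum_map_prodMk_left (f : Ω → α) (h : Ω → γ) (c : γ) :
    ∑' a, p.map (fun ω => (f ω, h ω)) (a, c) = p.map h c := by
  classical
  simp only [PMF.map_apply]
  rw [ENNReal.tsum_comm]
  refine tsum_congr fun ω => ?_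
  rw [tsum_eq_single (f ω) (fun a ha => by simp [ha])]
  simp

/-- The expectation of `P(f, h) P(g, h) / (P(f, g, h) P(h))` is at most `1`. -/
theorem tsum_mul_ratio_le_one (f : Ω → α) (g : Ω → β) (h : Ω → γ) :
    ∑' ω, p ω * (p.map (fun ω => (f ω, h ω)) (f ω, h ω) * p.map (fun ω => (g ω, h ω)) (g ω, h ω) /
      (p.map (fun ω => (h ω, f ω, g ω)) (h ω, f ω, g ω) * p.map h (h ω))) ≤ 1 := by
  rw [← tsum_map_mul p (fun ω => (h ω, f ω, g ω)) fun z =>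
    p.map (fun ω => (f ω, h ω)) (z.2.1, z.1) * p.map (fun ω => (g ω, h ω)) (z.2.2, z.1) /
      (p.map (fun ω => (h ω, f ω, g ω)) z * p.map h z.1)]
  calc _ ≤ ∑' z : γ × α × β, p.map (fun ω => (f ω, h ω)) (z.2.1, z.1) *
        p.map (fun ω => (g ω, h ω)) (z.2.2, z.1) * (p.map h z.1)⁻¹ := by
        -- Only an inequality: where `q` is positive it cancels, and where `q` is zero the left term
        -- vanishes while the right one need not.
        refine ENNReal.tsum_le_tsum fun z => ?_
        set q := p.map (fun ω => (h ω, f ω, g ω)) z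
        by_cases hq : q = 0
        · simp [hq]
        · have hq' : q ≠ ∞ := PMF.apply_ne_top _ _
          rw [div_eq_mul_inv, ENNReal.mul_inv (Or.inl hq) (Or.inl hq'), mul_left_comm,
            ← mul_assoc q, ENNReal.mul_inv_cancel hq hq', one_mul]
    _ = ∑' c : γ, p.map h c * p.map h c * (p.map h c)⁻¹ := by
        -- Summing over the values of `f` and of `g` marginalises each factor to the law of `h`.
        rw [ENNReal.tsum_prod']
        refine tsum_congr fun c => ?_
        rw [ENNReal.tsum_prod']
        simp only [ENNReal.tsum_mul_right, ENNReal.tsum_mul_left, tsum_map_prodMk_left]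
    _ ≤ ∑' c : γ, p.map h c := by
        refine ENNReal.tsum_le_tsum fun c => ?_
        rw [mul_assoc]
        exact mul_le_of_le_one_right zero_le (ENNReal.mul_inv_le_one _)
    _ = 1 := PMF.tsum_coe _

theorem eentropy_congr {f : Ω → α} {g : Ω → β} (h : ∀ ω ω', f ω = f ω' ↔ g ω = g ω') :
    eentropy p f = eentropy p g := by
  simp only [eentropy]
  refine tsum_congr fun ω => ?_
  rw [map_apply_congr p fun ω' => h ω ω']

/-- Crude subadditivity, enough for finiteness. With `R = P(f) P(g) / P(f, g)`, the bound `log R ≤ R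
- 1` gives `-log P(f, g) ≤ -log P(f) - log P(g) + R`, and `R` has expectation at most 1. Dropping
the `-1` avoids subtraction in `ℝ≥0∞`. -/
theorem eentropy_prodMk_le (f : Ω → α) (g : Ω → β) :
    eentropy p (fun ω => (f ω, g ω)) ≤ eentropy p f + eentropy p g + 1 := by
  refine le_trans ?_ (add_le_add_right
    (tsum_mul_ratio_le_one p f g (fun _ => ())) _)
  simp only [eentropy]
  rw [← ENNReal.tsum_add, ← ENNReal.tsum_add]
  refine ENNReal.tsum_le_tsum fun ω => ?_
  by_cases hω : p ω = 0
  · simp [hω]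
  rw [← mul_add, ← mul_add]
  gcongr
  have h1 : p.map (fun ω => (f ω, ())) (f ω, ()) = p.map f (f ω) :=
    map_apply_congr p (by simp)
  have h2 : p.map (fun ω => (g ω, ())) (g ω, ()) = p.map g (g ω) :=
    map_apply_congr p (by simp)
  have h3 : p.map (fun ω => ((), f ω, g ω)) ((), f ω, g ω) =
      p.map (fun ω => (f ω, g ω)) (f ω, g ω) :=
    map_apply_congr p (by simp)
  have h4 : p.map (fun _ => ()) () = 1 := by
    have := (p.map (fun _ => ())).tsum_coe
    rwa [tsum_eq_single () (fun y hy => absurd rfl hy)] at this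
  rw [h1, h2, h3, h4, mul_one]
  have p1 := toReal_map_pos p f hω
  have p2 := toReal_map_pos p g hω
  have p3 := toReal_map_pos p (fun ω => (f ω, g ω)) hω
  have hR : p.map f (f ω) * p.map g (g ω) / p.map (fun ω => (f ω, g ω)) (f ω, g ω) =
      ENNReal.ofReal ((p.map f (f ω)).toReal * (p.map g (g ω)).toReal /
        (p.map (fun ω => (f ω, g ω)) (f ω, g ω)).toReal) := by
    rw [ENNReal.ofReal_div_of_pos p3, ENNReal.ofReal_mul p1.le,
      ENNReal.ofReal_toReal (PMF.apply_ne_top _ _), ENNReal.ofReal_toReal (PMF.apply_ne_top _ _),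
      ENNReal.ofReal_toReal (PMF.apply_ne_top _ _)]
  rw [hR, ← ENNReal.ofReal_add (neg_log_nonneg _ _) (neg_log_nonneg _ _),
    ← ENNReal.ofReal_add (add_nonneg (neg_log_nonneg _ _) (neg_log_nonneg _ _)) (by positivity)]
  refine ENNReal.ofReal_le_ofReal ?_
  have := Real.log_le_sub_one_of_pos (div_pos (mul_pos p1 p2) p3)
  rw [Real.log_div (mul_pos p1 p2).ne' p3.ne', Real.log_mul p1.ne' p2.ne'] at this
  linarith

end Discrete

/-! ### Shannon's information measures under finite entropy -/

section Fields

variable {V : Type*} {X : V → Type*}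

theorem restrict_eq_iff {S : Finset V} {x y : ∀ i, X i} :
    S.restrict x = S.restrict y ↔ ∀ i ∈ S, x i = y i := by
  simp [funext_iff, Finset.restrict]

/-- As expectations over the one space of all outcomes, entropies of different sets of variables can
be combined term by term. -/
theorem entropy_eq_tsum (b : ℝ) (p : PMF (∀ i, X i)) (S : Finset V) :
    entropy b p S =
      (∑' x, (p x).toReal * -Real.log (marginal p S (S.restrict x)).toReal) / Real.log b := by
  rw [entropy, tsum_div_const]
  simp only [marginal]
  rw [tsum_negMulLog_map]

variable [DecidableEq V]

theorem eentropy_restrict_ne_top {p : PMF (∀ i, X i)} (hp : FiniteEntropy p) (S : Finset V) :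
    eentropy p (S.restrict : (∀ i, X i) → _) ≠ ∞ := by
  induction S using Finset.induction_on with
  | empty =>
    have : eentropy p ((∅ : Finset V).restrict : (∀ i, X i) → _) = eentropy p (fun _ => ()) :=
      eentropy_congr p (by simp [restrict_eq_iff])
    rw [this, eentropy_eq_tsum_negMulLog]
    simp
  | insert i S _ ih =>
    have : eentropy p ((insert i S).restrict : (∀ i, X i) → _) =
        eentropy p fun x => (({i} : Finset V).restrict x, S.restrict x) :=
      eentropy_congr p fun x y => by
        simp only [Prod.mk.injEq, restrict_eq_iff, Finset.forall_mem_insert,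
          Finset.mem_singleton, forall_eq]
    rw [this]
    refine ne_top_of_le_ne_top ?_ (eentropy_prodMk_le p _ _)
    refine ENNReal.add_ne_top.2 ⟨ENNReal.add_ne_top.2 ⟨?_, ih⟩, ENNReal.one_ne_top⟩
    rw [eentropy_eq_tsum_negMulLog]
    exact (hp i).tsum_ofReal_ne_top

theorem summable_surprisal_restrict {p : PMF (∀ i, X i)} (hp : FiniteEntropy p) (S : Finset V) :
    Summable fun x => (p x).toReal * -Real.log (marginal p S (S.restrict x)).toReal :=
  summable_surprisal p (eentropy_restrict_ne_top hp S)

theorem condMutualInfo_eq_tsum (b : ℝ) {p : PMF (∀ i, X i)} (hp : FiniteEntropy p)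
    (A B C : Finset V) :
    condMutualInfo b p A B C =
      (∑' x, (p x).toReal *
        (Real.log (marginal p (A ∪ B ∪ C) ((A ∪ B ∪ C).restrict x)).toReal +
          Real.log (marginal p C (C.restrict x)).toReal -
          Real.log (marginal p (A ∪ C) ((A ∪ C).restrict x)).toReal -
          Real.log (marginal p (B ∪ C) ((B ∪ C).restrict x)).toReal)) / Real.log b := by
  have h1 := summable_surprisal_restrict hp (A ∪ C)
  have h2 := summable_surprisal_restrict hp (B ∪ C)
  have h3 := summable_surprisal_restrict hp (A ∪ B ∪ C)
  have h4 := summable_surprisal_restrict hp C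
  rw [condMutualInfo, entropy_eq_tsum, entropy_eq_tsum, entropy_eq_tsum, entropy_eq_tsum]
  have h5 := ((h1.hasSum.add h2.hasSum).sub h3.hasSum).sub h4.hasSum
  refine Eq.trans ?_ (congrArg (· / Real.log b)
    (h5.tsum_eq.symm.trans (tsum_congr fun x => by ring)))
  ring

/-- Gibbs' inequality: up to `log b > 0`, the quantity is `E[-log R]` with `R = P(A, C) P(B, C) /
(P(A, B, C) P(C))`. Then `-log R ≥ 1 - R` on the support and `E[R] ≤ 1`. Finite entropy makes the
series of logarithms summable. -/
theorem condMutualInfo_nonneg {b : ℝ} (hb : 1 < b) {p : PMF (∀ i, X i)} (hp : FiniteEntropy p)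
    (A B C : Finset V) : 0 ≤ condMutualInfo b p A B C := by
  rw [condMutualInfo_eq_tsum b hp]
  refine div_nonneg ?_ (Real.log_pos hb).le
  have h1 := summable_surprisal_restrict hp (A ∪ C)
  have h2 := summable_surprisal_restrict hp (B ∪ C)
  have h3 := summable_surprisal_restrict hp (A ∪ B ∪ C)
  have h4 := summable_surprisal_restrict hp C
  have hs := ((h1.add h2).sub h3).sub h4
  have hR := tsum_mul_ratio_le_one p (A.restrict : (∀ i, X i) → _) (B.restrict : (∀ i, X i) → _)
    (C.restrict : (∀ i, X i) → _)
  have e1 : ∀ x, p.map (fun x => (A.restrict x, C.restrict x)) (A.restrict x, C.restrict x) =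
      marginal p (A ∪ C) ((A ∪ C).restrict x) := fun x => map_apply_congr p fun y => by
    simp only [Prod.mk.injEq, restrict_eq_iff, Finset.forall_mem_union]
  have e2 : ∀ x, p.map (fun x => (B.restrict x, C.restrict x)) (B.restrict x, C.restrict x) =
      marginal p (B ∪ C) ((B ∪ C).restrict x) := fun x => map_apply_congr p fun y => by
    simp only [Prod.mk.injEq, restrict_eq_iff, Finset.forall_mem_union]
  have e3 : ∀ x, p.map (fun x => (C.restrict x, A.restrict x, B.restrict x))
      (C.restrict x, A.restrict x, B.restrict x) =
      marginal p (A ∪ B ∪ C) ((A ∪ B ∪ C).restrict x) := fun x => map_apply_congr p fun y => by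
    simp only [Prod.mk.injEq, restrict_eq_iff, Finset.forall_mem_union]
    tauto
  have e4 : ∀ x, p.map C.restrict (C.restrict x) = marginal p C (C.restrict x) := fun _ => rfl
  simp only [e1, e2, e3, e4] at hR
  have hR1 := ENNReal.summable_toReal (ne_top_of_le_ne_top ENNReal.one_ne_top hR)
  have hR2 := ENNReal.toReal_mono ENNReal.one_ne_top hR
  have hp1 : HasSum (fun x => (p x).toReal) 1 := by
    have := p.tsum_coe
    have h' : Summable fun x => (p x).toReal := ENNReal.summable_toReal (by simp [this])
    have h'' := congrArg ENNReal.toReal this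
    rw [ENNReal.tsum_toReal_eq (fun x => PMF.apply_ne_top _ _), ENNReal.toReal_one] at h''
    exact h'' ▸ h'.hasSum
  rw [ENNReal.tsum_toReal_eq (fun x => ENNReal.ne_top_of_tsum_ne_top
    (ne_top_of_le_ne_top ENNReal.one_ne_top hR) x), ENNReal.toReal_one] at hR2
  calc (0 : ℝ) ≤ 1 - _ := sub_nonneg.2 hR2
    _ = _ := (hp1.sub hR1.hasSum).tsum_eq.symm
    _ ≤ _ := by
        refine Summable.tsum_le_tsum (fun x => ?_) (hp1.summable.sub hR1)
          (hs.congr fun x => by ring)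
        by_cases hx : p x = 0
        · simp [hx]
        have p1 : 0 < (marginal p (A ∪ C) ((A ∪ C).restrict x)).toReal := toReal_map_pos p _ hx
        have p2 : 0 < (marginal p (B ∪ C) ((B ∪ C).restrict x)).toReal := toReal_map_pos p _ hx
        have p3 : 0 < (marginal p (A ∪ B ∪ C) ((A ∪ B ∪ C).restrict x)).toReal :=
          toReal_map_pos p _ hx
        have p4 : 0 < (marginal p C (C.restrict x)).toReal := toReal_map_pos p _ hx
        simp only [ENNReal.toReal_mul, ENNReal.toReal_div]
        rw [← mul_one_sub]
        refine mul_le_mul_of_nonneg_left ?_ ENNReal.toReal_nonneg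
        have := Real.log_le_sub_one_of_pos (div_pos (mul_pos p1 p2) (mul_pos p3 p4))
        rw [Real.log_div (mul_pos p1 p2).ne' (mul_pos p3 p4).ne', Real.log_mul p1.ne' p2.ne',
          Real.log_mul p3.ne' p4.ne'] at this
        linarith

/-- The logarithm of the factorisation makes the summand vanish at every outcome of positive
probability. -/
theorem CondIndep.condMutualInfo_eq_zero (b : ℝ) {p : PMF (∀ i, X i)} (hp : FiniteEntropy p)
    {A B C : Finset V} (h : CondIndep p A B C) : condMutualInfo b p A B C = 0 := by
  rw [condMutualInfo_eq_tsum b hp]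
  refine div_eq_zero_iff.2 (Or.inl ?_)
  rw [← tsum_zero (β := ∀ i, X i)]
  refine tsum_congr fun x => ?_
  by_cases hx : p x = 0
  · simp [hx]
  have p1 : 0 < (marginal p (A ∪ C) ((A ∪ C).restrict x)).toReal := toReal_map_pos p _ hx
  have p2 : 0 < (marginal p (B ∪ C) ((B ∪ C).restrict x)).toReal := toReal_map_pos p _ hx
  have p3 : 0 < (marginal p (A ∪ B ∪ C) ((A ∪ B ∪ C).restrict x)).toReal := toReal_map_pos p _ hx
  have p4 : 0 < (marginal p C (C.restrict x)).toReal := toReal_map_pos p _ hx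
  have := congrArg (fun t => Real.log t.toReal) (h x)
  simp only [ENNReal.toReal_mul] at this
  rw [Real.log_mul p1.ne' p2.ne', Real.log_mul p3.ne' p4.ne'] at this
  rw [mul_eq_zero]
  right
  linarith

end Fields

end MRF

/-! ### The I-Measure on a path, and change of base -/

namespace MRF

open SimpleGraph

theorem isIMeasure_iMeasure {V : Type*} [Fintype V] [DecidableEq V] {X : V → Type*} (b : ℝ)
    (p : PMF (∀ i, X i)) : IsIMeasure b p (iMeasure b p) :=
  (existsUnique_isIMeasure b p).choose_spec.1

theorem signedMeasure_nonneg {V : Type*} [Finite V] {μ : MeasureTheory.SignedMeasure (InfoSpace V)}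
    (h : ∀ w : InfoSpace V, 0 ≤ μ {w}) : 0 ≤ μ := by
  classical
  have : Fintype (InfoSpace V) := Fintype.ofFinite _
  intro S _
  rw [signedMeasure_apply_eq_sum μ S]
  refine Finset.sum_nonneg fun w _ => ?_
  split_ifs
  · exact h w
  · exact le_rfl

/-- If all atoms in `S` other than `w` are null, then `S` has the measure of the atom `w`. -/
theorem signedMeasure_apply_eq_singleton {V : Type*} [Finite V]
    (μ : MeasureTheory.SignedMeasure (InfoSpace V)) {S : Set (InfoSpace V)} {w : InfoSpace V}
    (hw : w ∈ S) (h : ∀ z ∈ S, z ≠ w → μ {z} = 0) : μ S = μ {w} := by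
  classical
  have : Fintype (InfoSpace V) := Fintype.ofFinite _
  rw [signedMeasure_apply_eq_sum μ S, Finset.sum_eq_single w, if_pos hw]
  · intro z _ hz
    split_ifs with hS
    · exact h z hS hz
    · rfl
  · simp

/-- Each step moves one position along the path, so a walk avoiding `k` cannot jump over it. -/
theorem lt_iff_lt_of_reachable {V : Type*} {G : SimpleGraph V} {n : ℕ}
    (e : G ≃g pathGraph n) {U : Finset V} {k : V} (hk : k ∈ U) {x y : {v : V // v ∉ U}}
    (h : (G.induce {v : V | v ∉ U}).Reachable x y) :
    e x < e k ↔ e y < e k := by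
  obtain ⟨q⟩ := h
  induction q with
  | nil => rfl
  | @cons u v w huv q ih =>
    refine Iff.trans ?_ ih
    have hadj : G.Adj (u : V) v := huv
    rw [← e.map_adj_iff, pathGraph_adj] at hadj
    have hu : (e u : ℕ) ≠ e k := fun h' => u.2 (by rwa [e.injective (Fin.ext h')])
    have hv : (e v : ℕ) ≠ e k := fun h' => v.2 (by rwa [e.injective (Fin.ext h')])
    simp only [Fin.lt_def]
    omega

section Path

variable {V : Type*} [Fintype V] [DecidableEq V] {G : SimpleGraph V} {X : V → Type*} {n : ℕ}

/-- The complement of `W` contains `k`, so it separates the members of `W` before `k` from those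
after it. By the Markov property the set of their conditional mutual information has measure zero,
and strong induction removes all its atoms but `W`. -/
theorem iMeasure_singleton_eq_zero (e : G ≃g pathGraph n) (b : ℝ) {p : PMF (∀ i, X i)}
    (hp : FiniteEntropy p) (hM : IsMRF G p) (w : InfoSpace V) {a k c : V} (ha : a ∈ w.1)
    (hk : k ∉ w.1) (hc : c ∈ w.1) (hak : e a < e k) (hkc : e k < e c) :
    iMeasure b p {w} = 0 := by
  induction hW : w.1 using Finset.strongInduction generalizing w a c with
  | H W ih =>
    rw [hW] at ha hk hc
    have hI := isIMeasure_iMeasure b p (W.filter fun v => e v < e k)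
      (W.filter fun v => e k < e v) Wᶜ
    rw [CondIndep.condMutualInfo_eq_zero b hp] at hI
    · rw [← hI]
      symm
      refine signedMeasure_apply_eq_singleton _ ?_ ?_
      · simp only [Set.mem_sdiff, Set.mem_inter_iff, mem_setVarUnion, Finset.mem_filter,
          Finset.mem_compl, hW]
        exact ⟨⟨⟨a, ⟨ha, hak⟩, ha⟩, ⟨c, ⟨hc, hkc⟩, hc⟩⟩, fun ⟨i, h1, h2⟩ => h1 h2⟩
      -- The other atoms are proper subsets of `W` that still meet both sides of `k`.
      · intro z hz hne
        simp only [Set.mem_sdiff, Set.mem_inter_iff, mem_setVarUnion, Finset.mem_filter,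
          Finset.mem_compl] at hz
        obtain ⟨⟨⟨a', ha', ha''⟩, c', hc', hc''⟩, hsub⟩ := hz
        have hsub' : z.1 ⊆ W := fun i hi => by_contra fun hn => hsub ⟨i, hn, hi⟩
        have hss : z.1 ⊂ W := lt_of_le_of_ne hsub' fun h => hne (Subtype.ext (h.trans hW.symm))
        exact ih z.1 hss z ha'' (fun h => hk (hsub' h)) hc'' ha'.2 hc'.2 rfl
    · refine hM Wᶜ _ _ ?_ ?_ ?_ ?_ ?_
      · rw [Finset.disjoint_left]
        simp only [Finset.mem_compl, Finset.mem_filter]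
        tauto
      · rw [Finset.disjoint_left]
        simp only [Finset.mem_compl, Finset.mem_filter]
        tauto
      · rw [Finset.disjoint_left]
        simp only [Finset.mem_filter]
        exact fun v h1 h2 => lt_asymm h1.2 h2.2
      · ext v
        simp only [Finset.mem_union, Finset.mem_compl, Finset.mem_filter, Finset.mem_univ, iff_true]
        by_cases hv : v ∈ W
        · have : e v ≠ e k := fun h => hk (e.injective h ▸ hv)
          rcases lt_or_gt_of_ne this with h | h <;> simp [hv, h]
        · simp [hv]
      · intro x y hx hy hr
        rw [Finset.mem_filter] at hx hy
        exact lt_asymm hy.2 ((lt_iff_lt_of_reachable e (by simpa using hk) hr).1 hx.2)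

theorem iMeasure_nonneg_of_pathGraph (e : G ≃g pathGraph n) {b : ℝ} (hb : 1 < b)
    {p : PMF (∀ i, X i)} (hp : FiniteEntropy p) (hM : IsMRF G p) : 0 ≤ iMeasure b p := by
  refine signedMeasure_nonneg fun w => ?_
  obtain ⟨a, ha, hmin⟩ := Finset.exists_min_image w.1 e w.2
  obtain ⟨c, hc, hmax⟩ := Finset.exists_max_image w.1 e w.2
  by_cases hk : ∃ k ∉ w.1, e a < e k ∧ e k < e c
  · obtain ⟨k, hk, h1, h2⟩ := hk
    exact (iMeasure_singleton_eq_zero e b hp hM w ha hk hc h1 h2).ge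
  -- If `a = c` this is a conditional entropy. Any smaller atom containing both ends omits some
  -- vertex of `w`, strictly between `a` and `c`, and is null.
  · have hI := isIMeasure_iMeasure b p {a} {c} (w.1)ᶜ
    have hm : ∀ (z : InfoSpace V) (i : V), z ∈ setVarUnion {i} ↔ i ∈ z.1 := by
      simp [mem_setVarUnion]
    rw [signedMeasure_apply_eq_singleton (w := w)] at hI
    · rw [hI]
      exact condMutualInfo_nonneg hb hp _ _ _
    · simp only [Set.mem_sdiff, Set.mem_inter_iff, hm]
      refine ⟨⟨ha, hc⟩, ?_⟩
      rw [mem_setVarUnion]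
      rintro ⟨i, h1, h2⟩
      exact Finset.mem_compl.1 h1 h2
    · intro z hz hne
      simp only [Set.mem_sdiff, Set.mem_inter_iff, hm, mem_setVarUnion, Finset.mem_compl] at hz
      obtain ⟨⟨haz, hcz⟩, hsub⟩ := hz
      have hsub' : z.1 ⊆ w.1 := fun i hi => by_contra fun hn => hsub ⟨i, hn, hi⟩
      obtain ⟨k, hkw, hkz⟩ := Finset.exists_of_ssubset
        (lt_of_le_of_ne hsub' fun h => hne (Subtype.ext h))
      refine iMeasure_singleton_eq_zero e b hp hM z haz hkz hcz ?_ ?_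
      · refine lt_of_le_of_ne (hmin k hkw) fun h => hkz ?_
        rwa [← e.injective h]
      · refine lt_of_le_of_ne (hmax k hkw) fun h => hkz ?_
        rwa [e.injective h]

end Path

/-- All entropies scale by the same factor, and the I-Measure is unique. -/
theorem iMeasure_apply_eq_mul {V : Type*} [Fintype V] [DecidableEq V] {X : V → Type*} (b c : ℝ)
    (hc : Real.log c ≠ 0) (p : PMF (∀ i, X i)) (S : Set (InfoSpace V)) :
    iMeasure b p S = Real.log c / Real.log b * iMeasure c p S := by
  have hH : ∀ A : Finset V, entropy b p A = Real.log c / Real.log b * entropy c p A := by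
    intro A
    rw [entropy_eq_tsum, entropy_eq_tsum]
    field_simp
  have h : IsIMeasure b p ((Real.log c / Real.log b) • iMeasure c p) := by
    intro A B C
    rw [FunLike.coe_smul, Pi.smul_apply, isIMeasure_iMeasure c p A B C, condMutualInfo,
      condMutualInfo]
    simp only [hH, smul_eq_mul]
    ring
  rw [(existsUnique_isIMeasure b p).unique (isIMeasure_iMeasure b p) h, FunLike.coe_smul,
    Pi.smul_apply, smul_eq_mul]

theorem not_nonneg_of_atom_neg {V : Type*} [Fintype V] [DecidableEq V] {X : V → Type*} {b c : ℝ}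
    (hb : 1 < b) (hc : 1 < c) (p : PMF (∀ i, X i)) {W : Finset V}
    (h : iMeasure c p (atom W) < 0) : ¬ 0 ≤ iMeasure b p := by
  intro h0
  have h1 := h0 (atom W) (measurableSet_infoSpace _)
  rw [iMeasure_apply_eq_mul b c (Real.log_pos hc).ne'] at h1
  have := mul_neg_of_pos_of_neg (div_pos (Real.log_pos hc) (Real.log_pos hb)) h
  exact absurd h1 (not_le.2 this)

end MRF

/-! ### Images of a finite uniform law -/

namespace MRF

open SimpleGraph

section Law

variable {V : Type*} {X : V → Type*} {Ω : Type*}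

theorem marginal_map_restrict (q : PMF Ω) (φ : Ω → ∀ i, X i) (S : Finset V) (x : ∀ i, X i)
    [DecidablePred fun ω => ∀ i ∈ S, φ ω i = x i] :
    marginal (q.map φ) S (S.restrict x) = ∑' ω, if ∀ i ∈ S, φ ω i = x i then q ω else 0 := by
  classical
  rw [marginal, PMF.map_comp, PMF.map_apply]
  refine tsum_congr fun ω => ?_
  simp only [Function.comp_apply, restrict_eq_iff, eq_comm (b := φ ω _)]

theorem finiteEntropy_of_finite [∀ i, Finite (X i)] (p : PMF (∀ i, X i)) : FiniteEntropy p :=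
  fun _ => Summable.of_finite

/-- If all fibres have `k` elements, the surprisal is constant, so its mean is that constant. -/
theorem entropy_map_uniform [Fintype Ω] [Nonempty Ω] (b : ℝ) (φ : Ω → ∀ i, X i) (S : Finset V)
    (k : ℕ) [∀ ω, DecidablePred fun ω' => ∀ i ∈ S, φ ω' i = φ ω i]
    (hk : ∀ ω, (Finset.univ.filter fun ω' => ∀ i ∈ S, φ ω' i = φ ω i).card = k) :
    entropy b ((PMF.uniformOfFintype Ω).map φ) S =
      Real.log (Fintype.card Ω / k) / Real.log b := by
  have hN : (Fintype.card Ω : ℝ) ≠ 0 := by simp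
  have hm : ∀ ω, (PMF.uniformOfFintype Ω).map (S.restrict ∘ φ) (S.restrict (φ ω)) =
      k * (Fintype.card Ω : ENNReal)⁻¹ := by
    intro ω
    rw [← PMF.map_comp]
    have := marginal_map_restrict (PMF.uniformOfFintype Ω) φ S (φ ω)
    rw [marginal] at this
    rw [this, tsum_fintype, ← Finset.sum_filter]
    simp [hk]
  rw [entropy, tsum_div_const]
  congr 1
  rw [marginal, PMF.map_comp, tsum_negMulLog_map, tsum_fintype]
  simp only [Function.comp_apply, hm, PMF.uniformOfFintype_apply, ENNReal.toReal_mul,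
    ENNReal.toReal_inv, ENNReal.toReal_natCast, Finset.sum_const, Finset.card_univ, nsmul_eq_mul]
  rw [← mul_assoc, mul_inv_cancel₀ hN, one_mul, ← Real.log_inv, mul_inv, inv_inv, mul_comm,
    div_eq_mul_inv]

variable [DecidableEq V]

theorem CondIndep.symm {p : PMF (∀ i, X i)} {A B C : Finset V} (h : CondIndep p A B C) :
    CondIndep p B A C := by
  intro x
  have := h x
  rw [Finset.union_comm B A, this, mul_comm]

/-- If `X_C` determines `X_B`, then `X_B` is independent of everything conditioning on `X_C`. -/
theorem condIndep_of_determined (q : PMF Ω) (φ : Ω → ∀ i, X i) (A : Finset V) {B C : Finset V}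
    (h : ∀ ω ω', (∀ i ∈ C, φ ω i = φ ω' i) → ∀ i ∈ B, φ ω i = φ ω' i) :
    CondIndep (q.map φ) A B C := by
  classical
  intro x
  simp only [marginal_map_restrict]
  -- If the values on `B ∪ C` occur, those on `B` are implied by those on `C` and drop out of both
  -- events; otherwise each side has a zero factor.
  by_cases hx : ∃ ω, ∀ i ∈ B ∪ C, φ ω i = x i
  · obtain ⟨ω, hω⟩ := hx
    have key : ∀ ω', (∀ i ∈ C, φ ω' i = x i) → ∀ i ∈ B, φ ω' i = x i := by
      intro ω' hC i hi
      rw [h ω' ω (fun j hj => by rw [hC j hj, hω j (Finset.mem_union_right _ hj)]) i hi]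
      exact hω i (Finset.mem_union_left _ hi)
    have h1 : ∀ ω', (∀ i ∈ A ∪ B ∪ C, φ ω' i = x i) ↔ ∀ i ∈ A ∪ C, φ ω' i = x i := by
      intro ω'
      simp only [Finset.forall_mem_union]
      exact ⟨fun h => ⟨h.1.1, h.2⟩, fun h => ⟨⟨h.1, key ω' h.2⟩, h.2⟩⟩
    have h2 : ∀ ω', (∀ i ∈ B ∪ C, φ ω' i = x i) ↔ ∀ i ∈ C, φ ω' i = x i := by
      intro ω'
      simp only [Finset.forall_mem_union]
      exact ⟨fun h => h.2, fun h => ⟨key ω' h, h⟩⟩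
    simp only [h1, h2]
  · have h1 : ∀ ω, ¬ ∀ i ∈ B ∪ C, φ ω i = x i := fun ω hω => hx ⟨ω, hω⟩
    have h2 : ∀ ω, ¬ ∀ i ∈ A ∪ B ∪ C, φ ω i = x i := by
      intro ω hω
      simp only [Finset.forall_mem_union] at hω h1
      exact h1 ω ⟨hω.1.2, hω.2⟩
    simp only [h1, h2, if_false, tsum_zero, zero_mul, mul_zero]

end Law

/-! ### Computing atoms from entropies -/

section Atoms

theorem mem_atom {V : Type*} {W : Finset V} {w : InfoSpace V} : w ∈ atom W ↔ w.1 = W := by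
  simp only [atom, setVar, Set.mem_sdiff, Set.mem_iInter, Set.mem_ofPred_eq, Set.mem_iUnion,
    not_exists]
  constructor
  · rintro ⟨h1, h2⟩
    ext i
    exact ⟨fun hi => by_contra fun hn => h2 i hn hi, h1 i⟩
  · rintro rfl
    exact ⟨fun i hi => hi, fun i hi h => hi h⟩

theorem setVarUnion_union {V : Type*} [DecidableEq V] (A B : Finset V) :
    setVarUnion (A ∪ B) = setVarUnion A ∪ setVarUnion B := by
  ext w
  simp only [Set.mem_union, mem_setVarUnion, Finset.mem_union, or_and_right, exists_or]

/-- Inclusion-exclusion: it reduces a fourfold intersection to sets that carry conditional mutual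
informations. -/
theorem signedMeasure_inter_inter {V : Type*} [Finite V]
    (μ : MeasureTheory.SignedMeasure (InfoSpace V)) (S P Q : Set (InfoSpace V)) :
    μ (S ∩ P ∩ Q) = μ S - μ (S \ P) - μ (S \ Q) + μ (S \ (P ∪ Q)) := by
  classical
  have : Fintype (InfoSpace V) := Fintype.ofFinite _
  rw [signedMeasure_apply_eq_sum μ S, signedMeasure_apply_eq_sum μ (S ∩ P ∩ Q),
    signedMeasure_apply_eq_sum μ (S \ P), signedMeasure_apply_eq_sum μ (S \ Q),
    signedMeasure_apply_eq_sum μ (S \ (P ∪ Q)), ← Finset.sum_sub_distrib,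
    ← Finset.sum_sub_distrib, ← Finset.sum_add_distrib]
  refine Finset.sum_congr rfl fun w _ => ?_
  by_cases h1 : w ∈ S <;> by_cases h2 : w ∈ P <;> by_cases h3 : w ∈ Q <;> simp [h1, h2, h3]

/-- Uniqueness in Möbius inversion: the value at `W` is the sum over its subsets less the values at
proper subsets. -/
theorem eq_of_sum_powerset_eq {V : Type*} [DecidableEq V] {f g : Finset V → ℝ}
    (h : ∀ S : Finset V, ∑ W ∈ S.powerset, f W = ∑ W ∈ S.powerset, g W) (W : Finset V) :
    f W = g W := by
  induction W using Finset.strongInduction with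
  | H W ih =>
    have h' := h W
    rw [← Finset.insert_erase (Finset.mem_powerset_self W), Finset.sum_insert (by simp),
      Finset.sum_insert (by simp)] at h'
    have h2 : ∑ x ∈ W.powerset.erase W, f x = ∑ x ∈ W.powerset.erase W, g x :=
      Finset.sum_congr rfl fun x hx => ih x (Finset.mem_ssubsets.1 hx)
    linarith

variable {V : Type*} [Fintype V] [DecidableEq V] {X : V → Type*}

/-- The atoms inside `S` make up the set of `H(X_S | X_{Sᶜ})`. The term `W = ∅` is harmless, its
atom being the empty set. -/
theorem sum_powerset_iMeasure_atom (b : ℝ) (p : PMF (∀ i, X i)) (S : Finset V) :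
    ∑ W ∈ S.powerset, iMeasure b p (atom W) = entropy b p Finset.univ - entropy b p Sᶜ := by
  have hI := isIMeasure_iMeasure b p Finset.univ Finset.univ Sᶜ
  have hset : (setVarUnion Finset.univ ∩ setVarUnion Finset.univ) \ setVarUnion Sᶜ =
      ⋃ W ∈ S.powerset, atom W := by
    ext w
    simp only [Set.inter_self, Set.mem_sdiff, mem_setVarUnion, Finset.mem_univ, true_and,
      Finset.mem_compl, Set.mem_iUnion, mem_atom, Finset.mem_powerset, exists_prop,
      exists_eq_right']
    constructor
    · rintro ⟨_, h⟩ i hi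
      exact by_contra fun hn => h ⟨i, hn, hi⟩
    · exact fun h => ⟨w.2, fun ⟨i, h1, h2⟩ => h1 (h h2)⟩
  rw [hset, MeasureTheory.VectorMeasure.of_biUnion_finset] at hI
  · rw [hI, condMutualInfo, Finset.union_self, Finset.union_eq_left.2 (Finset.subset_univ _)]
    ring
  · intro A _ B _ hAB
    rw [Function.onFun, Set.disjoint_left]
    intro w hA hB
    exact hAB ((mem_atom.1 hA).symm.trans (mem_atom.1 hB))
  · exact fun _ _ => measurableSet_infoSpace _

end Atoms

/-! ### A vertex of degree at least three -/

section Xor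

variable {V : Type*} [DecidableEq V]

/-- The values of the random variables of `xorLaw` at the outcome `ω = (Z, T)`. -/
def xorValue (u : V) (v : Fin 3 → V) (ω : ZMod 2 × ZMod 2) (i : V) : ZMod 2 × ZMod 2 :=
  if i = v 0 then (ω.1, 0)
  else if i = v 1 then (ω.2, 0)
  else if i = v 2 then (ω.1 + ω.2, 0)
  else if i = u then ω
  else 0

theorem xorLaw_eq_map (u : V) (v : Fin 3 → V) :
    xorLaw u v = (PMF.uniformOfFintype (ZMod 2 × ZMod 2)).map (xorValue u v) := rfl

variable {u : V} {v : Fin 3 → V}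

theorem xorValue_zero (ω : ZMod 2 × ZMod 2) : xorValue u v ω (v 0) = (ω.1, 0) := by
  simp [xorValue]

theorem xorValue_one (hv : Function.Injective v) (ω : ZMod 2 × ZMod 2) :
    xorValue u v ω (v 1) = (ω.2, 0) := by
  simp [xorValue, hv.eq_iff]

theorem xorValue_two (hv : Function.Injective v) (ω : ZMod 2 × ZMod 2) :
    xorValue u v ω (v 2) = (ω.1 + ω.2, 0) := by
  simp [xorValue, hv.eq_iff]

theorem xorValue_center (hu : ∀ l, u ≠ v l) (ω : ZMod 2 × ZMod 2) : xorValue u v ω u = ω := by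
  simp [xorValue, hu]

theorem xorValue_of_ne {i : V} (hi : i ≠ u) (h : ∀ l, i ≠ v l) (ω : ZMod 2 × ZMod 2) :
    xorValue u v ω i = 0 := by
  simp [xorValue, hi, h]

/-- If `u ∈ U`, conditioning on `X_u` fixes everything. Otherwise the side without `u` contains no
`v l`, being disconnected from `u`, so all its variables are constant. -/
theorem isMRF_xorLaw [Fintype V] {G : SimpleGraph V} (hadj : ∀ l, G.Adj u (v l)) :
    IsMRF G (xorLaw u v) := by
  have hu : ∀ l, u ≠ v l := fun l => (hadj l).ne
  intro U V₁ V₂ h1 h2 h12 huniv hsep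
  rw [xorLaw_eq_map]
  have key : ∀ A B : Finset V, Disjoint U A → Disjoint U B → Disjoint A B → u ∈ A →
      (∀ a b : {v : V // v ∉ U}, (a : V) ∈ A → (b : V) ∈ B →
        ¬ (G.induce {v : V | v ∉ U}).Reachable a b) →
      CondIndep ((PMF.uniformOfFintype (ZMod 2 × ZMod 2)).map (xorValue u v)) A B U := by
    intro A B hA hB hAB huA hs
    refine condIndep_of_determined _ _ _ fun ω ω' _ i hi => ?_
    have hiu : i ≠ u := fun h => Finset.disjoint_left.1 hAB huA (h ▸ hi)
    have hiv : ∀ l, i ≠ v l := by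
      rintro l rfl
      refine hs ⟨u, Finset.disjoint_right.1 hA huA⟩ ⟨v l, Finset.disjoint_right.1 hB hi⟩ huA hi ?_
      exact Adj.reachable (show G.Adj u (v l) from hadj l)
    rw [xorValue_of_ne hiu hiv, xorValue_of_ne hiu hiv]
  have hmem : u ∈ U ∪ V₁ ∪ V₂ := huniv ▸ Finset.mem_univ u
  simp only [Finset.mem_union] at hmem
  rcases hmem with (hm | hm) | hm
  · refine condIndep_of_determined _ _ _ fun ω ω' h i _ => ?_
    have := h u hm
    rw [xorValue_center hu, xorValue_center hu] at this
    rw [this]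
  · exact key V₁ V₂ h1 h2 h12 hm hsep
  · exact (key V₂ V₁ h2 h1 h12.symm hm fun a b ha hb hr => hsep b a hb ha hr.symm).symm

theorem entropy_xorLaw_eq_two {S : Finset V}
    (h : ∀ ω ω', (∀ i ∈ S, xorValue u v ω i = xorValue u v ω' i) → ω = ω') :
    entropy 2 (xorLaw u v) S = 2 := by
  rw [xorLaw_eq_map, entropy_map_uniform 2 (xorValue u v) S 1]
  · have : ((Fintype.card (ZMod 2 × ZMod 2) : ℕ) : ℝ) / (1 : ℕ) = 2 ^ 2 := by
      simp; norm_num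
    rw [this, Real.log_pow, Nat.cast_ofNat, mul_div_assoc, div_self (Real.log_pos one_lt_two).ne',
      mul_one]
  · intro ω
    rw [Finset.card_eq_one]
    refine ⟨ω, ?_⟩
    ext ω'
    simp only [Finset.mem_filter, Finset.mem_univ, true_and, Finset.mem_singleton]
    exact ⟨h ω' ω, by rintro rfl; simp⟩

theorem entropy_xorLaw_eq_one {S : Finset V} (f : ZMod 2 × ZMod 2 → ZMod 2)
    (hf : ∀ ω, (Finset.univ.filter fun ω' => f ω' = f ω).card = 2)
    (h : ∀ ω ω', (∀ i ∈ S, xorValue u v ω i = xorValue u v ω' i) ↔ f ω = f ω') :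
    entropy 2 (xorLaw u v) S = 1 := by
  rw [xorLaw_eq_map, entropy_map_uniform 2 (xorValue u v) S 2]
  · have : ((Fintype.card (ZMod 2 × ZMod 2) : ℕ) : ℝ) / (2 : ℕ) = 2 := by
      simp; norm_num
    rw [this, div_self (Real.log_pos one_lt_two).ne']
  · intro ω
    simp only [h]
    exact hf ω

theorem entropy_xorLaw_eq_zero {S : Finset V}
    (h : ∀ ω ω', ∀ i ∈ S, xorValue u v ω i = xorValue u v ω' i) :
    entropy 2 (xorLaw u v) S = 0 := by
  rw [xorLaw_eq_map, entropy_map_uniform 2 (xorValue u v) S 4]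
  · simp
  · intro ω
    rw [Finset.filter_true_of_mem fun ω' _ => h ω' ω]
    simp

/-- With `S` the set of `I(X_{v 0}; X_{v 1} | X_R)`, the four terms of inclusion-exclusion are 0
unconditionally on the sum, 1 given `X_{v 2}`, 0 given `X_u`, and 0 given both, whence `0 - 1 - 0 +
0`. -/
theorem iMeasure_xorLaw_atom [Fintype V] (hv : Function.Injective v) (hu : ∀ l, u ≠ v l) :
    iMeasure 2 (xorLaw u v) (atom {u, v 0, v 1, v 2}) = -1 := by
  set R : Finset V := {u, v 0, v 1, v 2}ᶜ with hR
  set μ := iMeasure 2 (xorLaw u v)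
  have hset : atom {u, v 0, v 1, v 2} =
      ((setVarUnion {v 0} ∩ setVarUnion {v 1}) \ setVarUnion R) ∩ setVarUnion {v 2} ∩
        setVarUnion {u} := by
    ext w
    simp only [mem_atom, Set.mem_inter_iff, Set.mem_sdiff, mem_setVarUnion, Finset.mem_singleton,
      exists_eq_left, hR, Finset.mem_compl]
    constructor
    · intro h
      rw [h]
      simp
    · rintro ⟨⟨⟨⟨h0, h1⟩, hn⟩, h2⟩, h3⟩
      refine Finset.Subset.antisymm (fun i hi => by_contra fun h => hn ⟨i, h, hi⟩) ?_
      simp only [Finset.insert_subset_iff, Finset.singleton_subset_iff]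
      exact ⟨h3, h0, h1, h2⟩
  have hconst : ∀ ω ω', ∀ i ∈ R, xorValue u v ω i = xorValue u v ω' i := by
    intro ω ω' i hi
    simp only [hR, Finset.mem_compl, Finset.mem_insert, Finset.mem_singleton, not_or] at hi
    have hl : ∀ l, i ≠ v l := by
      intro l
      fin_cases l
      exacts [hi.2.1, hi.2.2.1, hi.2.2.2]
    rw [xorValue_of_ne hi.1 hl, xorValue_of_ne hi.1 hl]
  have hcenter : ∀ S : Finset V, u ∈ S → entropy 2 (xorLaw u v) S = 2 := fun S hS =>
    entropy_xorLaw_eq_two fun ω ω' h => by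
      simpa only [xorValue_center hu] using h u hS
  have h01 : ∀ S : Finset V, v 0 ∈ S → v 1 ∈ S → entropy 2 (xorLaw u v) S = 2 :=
    fun S h0 h1 => entropy_xorLaw_eq_two fun ω ω' h => by
      have e0 := h _ h0
      have e1 := h _ h1
      simp only [xorValue_zero, xorValue_one hv, Prod.mk.injEq, and_true] at e0 e1
      exact Prod.ext e0 e1
  have h02 : ∀ S : Finset V, v 0 ∈ S → v 2 ∈ S → entropy 2 (xorLaw u v) S = 2 :=
    fun S h0 h2 => entropy_xorLaw_eq_two fun ω ω' h => by
      have e0 := h _ h0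
      have e2 := h _ h2
      simp only [xorValue_zero, xorValue_two hv, Prod.mk.injEq, and_true] at e0 e2
      rw [e0, add_right_inj] at e2
      exact Prod.ext e0 e2
  have h12 : ∀ S : Finset V, v 1 ∈ S → v 2 ∈ S → entropy 2 (xorLaw u v) S = 2 :=
    fun S h1 h2 => entropy_xorLaw_eq_two fun ω ω' h => by
      have e1 := h _ h1
      have e2 := h _ h2
      simp only [xorValue_one hv, xorValue_two hv, Prod.mk.injEq, and_true] at e1 e2
      rw [e1, add_left_inj] at e2
      exact Prod.ext e2 e1
  have s0 : entropy 2 (xorLaw u v) ({v 0} ∪ R) = 1 :=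
    entropy_xorLaw_eq_one (fun ω => ω.1) (by decide) fun ω ω' => by
      simp only [Finset.forall_mem_union, Finset.mem_singleton, forall_eq, xorValue_zero,
        Prod.mk.injEq, and_true]
      exact and_iff_left (hconst ω ω')
  have s1 : entropy 2 (xorLaw u v) ({v 1} ∪ R) = 1 :=
    entropy_xorLaw_eq_one (fun ω => ω.2) (by decide) fun ω ω' => by
      simp only [Finset.forall_mem_union, Finset.mem_singleton, forall_eq, xorValue_one hv,
        Prod.mk.injEq, and_true]
      exact and_iff_left (hconst ω ω')
  have s2 : entropy 2 (xorLaw u v) (R ∪ {v 2}) = 1 :=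
    entropy_xorLaw_eq_one (fun ω => ω.1 + ω.2) (by decide) fun ω ω' => by
      simp only [Finset.forall_mem_union, Finset.mem_singleton, forall_eq, xorValue_two hv,
        Prod.mk.injEq, and_true]
      exact and_iff_right (hconst ω ω')
  have sR : entropy 2 (xorLaw u v) R = 0 := entropy_xorLaw_eq_zero hconst
  have hI := isIMeasure_iMeasure 2 (xorLaw u v) {v 0} {v 1}
  rw [hset, signedMeasure_inter_inter]
  simp only [Set.sdiff_sdiff, ← setVarUnion_union]
  rw [hI, hI, hI, hI, condMutualInfo, condMutualInfo, condMutualInfo, condMutualInfo, s0, s1, sR,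
    s2, h01 ({v 0} ∪ {v 1} ∪ R) (by simp) (by simp), h02 ({v 0} ∪ (R ∪ {v 2})) (by simp) (by simp),
    h12 ({v 1} ∪ (R ∪ {v 2})) (by simp) (by simp), h01 ({v 0} ∪ {v 1} ∪ _) (by simp) (by simp),
    hcenter ({v 0} ∪ (R ∪ {u})) (by simp), hcenter ({v 1} ∪ (R ∪ {u})) (by simp),
    hcenter (R ∪ {u}) (by simp), h01 ({v 0} ∪ {v 1} ∪ _) (by simp) (by simp),
    hcenter ({v 0} ∪ _) (by simp), hcenter ({v 1} ∪ _) (by simp),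
    hcenter (R ∪ ({v 2} ∪ {u})) (by simp), h01 ({v 0} ∪ {v 1} ∪ _) (by simp) (by simp)]
  norm_num

end Xor

end MRF

/-! ### Cycles and the finite-field construction -/

namespace MRF

open SimpleGraph

section Field

/-- A cycle stays connected without one vertex `u`: every other vertex walks backwards round the
cycle to the successor of `u`. -/
theorem reachable_of_cycleGraph {V : Type*} [DecidableEq V] {G : SimpleGraph V} {n : ℕ}
    (e : G ≃g cycleGraph (n + 3)) {U : Finset V} (hU : U.card ≤ 1) (a b : {v : V // v ∉ U}) :
    (G.induce {v : V | v ∉ U}).Reachable a b := by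
  have hV : Finite V := Finite.of_equiv _ e.symm.toEquiv
  have := Fintype.ofFinite V
  obtain ⟨u, hUu, hau, hbu⟩ : ∃ u, U ⊆ {u} ∧ (a : V) ≠ u ∧ (b : V) ≠ u := by
    rcases U.eq_empty_or_nonempty with rfl | ⟨u, hu⟩
    -- When nothing is removed, any third vertex serves as `u`; one exists as there are at least
    -- three vertices.
    · have hc : ({(a : V), (b : V)} : Finset V).card < Fintype.card V := by
        rw [Fintype.card_congr e.toEquiv, Fintype.card_fin]
        exact lt_of_le_of_lt Finset.card_le_two (by omega)
      obtain ⟨u, hu⟩ := Finset.exists_mem_notMem_of_card_lt_card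
        (s := {(a : V), (b : V)}) (t := Finset.univ) (by simpa using hc)
      simp only [Finset.mem_insert, Finset.mem_singleton, not_or] at hu
      exact ⟨u, by simp, fun h => hu.2.1 h.symm, fun h => hu.2.2 h.symm⟩
    · refine ⟨u, fun x hx => ?_, fun h => a.2 (h ▸ hu), fun h => b.2 (h ▸ hu)⟩
      rw [Finset.mem_singleton]
      exact Finset.card_le_one.1 hU x hx u hu
  have hmem : ∀ z, z ≠ e u → e.symm z ∉ U := by
    intro z hz h
    have := Finset.mem_singleton.1 (hUu h)
    exact hz (by rw [← this, e.apply_symm_apply])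
  have h1 : e u + 1 ≠ e u := by simp
  suffices h : ∀ (m : ℕ) (x : {v : V // v ∉ U}), (e x - e u).val = m + 1 →
      (G.induce {v : V | v ∉ U}).Reachable x ⟨e.symm (e u + 1), hmem _ h1⟩ by
    have h' : ∀ x : {v : V // v ∉ U}, (x : V) ≠ u →
        (G.induce {v : V | v ∉ U}).Reachable x ⟨e.symm (e u + 1), hmem _ h1⟩ := by
      intro x hx
      refine h ((e x - e u).val - 1) x ?_
      have : (e x - e u).val ≠ 0 := by
        rw [Fin.val_ne_zero_iff, sub_ne_zero]
        exact fun h => hx (e.injective h)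
      omega
    exact (h' a hau).trans (h' b hbu).symm
  intro m
  induction m with
  | zero =>
    intro x hx
    have h2 : e x - e u = 1 := Fin.ext (by simpa using hx)
    have h3 : x = ⟨e.symm (e u + 1), hmem _ h1⟩ := by
      apply Subtype.ext
      change (x : V) = e.symm (e u + 1)
      rw [← h2, add_sub_cancel, e.symm_apply_apply]
    rw [h3]
  | succ m ih =>
    intro x hx
    have h2 : (e x - 1 - e u).val = m + 1 := by
      rw [sub_right_comm, Fin.coe_sub_one, if_neg, hx]
      · rfl
      · intro h
        rw [h] at hx
        simp at hx
    have h3 : e x - 1 ≠ e u := by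
      intro h
      rw [h, sub_self] at h2
      simp at h2
    refine Reachable.trans (Adj.reachable ?_) (ih ⟨e.symm (e x - 1), hmem _ h3⟩ ?_)
    · change G.Adj x (e.symm (e x - 1))
      rw [← e.map_adj_iff, e.apply_symm_apply, cycleGraph_adj]
      simp
    · simpa using h2

variable {V : Type*} {n : ℕ} {F : Type*} [Field F]

/-- The values of the random variables of `fieldLaw` at the outcome `ω = (Z, T)`. -/
def fieldValue (e : V → Fin n) (α : Fin n → F) (ω : F × F) (i : V) : F :=
  if (e i : ℕ) = 0 then ω.1
  else if (e i : ℕ) = 1 then ω.2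
  else ω.1 + α (e i) * ω.2

theorem fieldLaw_eq_map [Fintype F] (e : V → Fin n) (α : Fin n → F) :
    fieldLaw e F α = (PMF.uniformOfFintype (F × F)).map (fieldValue e α) := rfl

variable {e : V → Fin n} {α : Fin n → F}

/-- Any two of the variables determine the outcome. -/
theorem eq_of_fieldValue_eq (he : Function.Injective e) (h0 : ∀ k : Fin n, 2 ≤ (k : ℕ) → α k ≠ 0)
    (hα : Set.InjOn α {k : Fin n | 2 ≤ (k : ℕ)}) {i j : V} (hij : i ≠ j) {ω ω' : F × F}
    (hi : fieldValue e α ω i = fieldValue e α ω' i)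
    (hj : fieldValue e α ω j = fieldValue e α ω' j) : ω = ω' := by
  have hne : (e i : ℕ) ≠ e j := fun h => hij (he (Fin.ext h))
  obtain ⟨z, t⟩ := ω
  obtain ⟨z', t'⟩ := ω'
  simp only [fieldValue] at hi hj
  rw [Prod.mk.injEq]
  have hk : ∀ k : Fin n, (k : ℕ) ≠ 0 → (k : ℕ) ≠ 1 → α k ≠ 0 := fun k _ _ => h0 k (by omega)
  split_ifs at hi hj with h1 h2 h3 h4 h5 h6 h7
  · omega
  · exact ⟨hi, hj⟩
  · subst hi
    exact ⟨rfl, mul_left_cancel₀ (hk _ h2 h3) (add_left_cancel hj)⟩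
  · exact ⟨hj, hi⟩
  · omega
  · subst hi
    exact ⟨add_right_cancel hj, rfl⟩
  · subst hj
    exact ⟨rfl, mul_left_cancel₀ (hk _ h1 h4) (add_left_cancel hi)⟩
  · subst hj
    exact ⟨add_right_cancel hi, rfl⟩
  -- Subtracting the two equations leaves `(α_i - α_j) (t - t') = 0`.
  · have hd : α (e i) - α (e j) ≠ 0 := by
      rw [sub_ne_zero]
      intro h
      exact hij (he (hα (show 2 ≤ (e i : ℕ) by omega) (show 2 ≤ (e j : ℕ) by omega) h))
    have ht : t = t' := by
      apply mul_left_cancel₀ hd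
      linear_combination hi - hj
    subst ht
    exact ⟨add_right_cancel hi, rfl⟩

theorem eq_of_forall_mem_fieldValue_eq (he : Function.Injective e)
    (h0 : ∀ k : Fin n, 2 ≤ (k : ℕ) → α k ≠ 0) (hα : Set.InjOn α {k : Fin n | 2 ≤ (k : ℕ)})
    {S : Finset V} (hS : 2 ≤ S.card) {ω ω' : F × F}
    (h : ∀ i ∈ S, fieldValue e α ω i = fieldValue e α ω' i) : ω = ω' := by
  obtain ⟨i, hi, j, hj, hij⟩ := Finset.one_lt_card.1 hS
  exact eq_of_fieldValue_eq he h0 hα hij (h i hi) (h j hj)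

variable [Fintype F]

/-- Two variables in `U` determine all the others. If `U` has at most one vertex, its complement is
connected, so one of the two sides is empty. -/
theorem isMRF_fieldLaw [Fintype V] [DecidableEq V] {G : SimpleGraph V} (hn : 3 ≤ n)
    (e : G ≃g cycleGraph n) (h0 : ∀ k : Fin n, 2 ≤ (k : ℕ) → α k ≠ 0)
    (hα : Set.InjOn α {k : Fin n | 2 ≤ (k : ℕ)}) : IsMRF G (fieldLaw e F α) := by
  intro U V₁ V₂ h1 h2 h12 huniv hsep
  rw [fieldLaw_eq_map]
  by_cases hU : 2 ≤ U.card
  · refine condIndep_of_determined _ _ _ fun ω ω' h i _ => ?_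
    rw [eq_of_forall_mem_fieldValue_eq e.injective h0 hα hU h]
  rcases V₂.eq_empty_or_nonempty with rfl | ⟨y, hy⟩
  · exact condIndep_of_determined _ _ _ fun ω ω' _ i hi => by simp at hi
  rcases V₁.eq_empty_or_nonempty with rfl | ⟨x, hx⟩
  · exact (condIndep_of_determined _ _ _ fun ω ω' _ i hi => by simp at hi).symm
  obtain ⟨m, rfl⟩ := Nat.exists_eq_add_of_le' hn
  exact absurd (reachable_of_cycleGraph e (by omega) _ _) (hsep ⟨x, Finset.disjoint_right.1 h1 hx⟩
    ⟨y, Finset.disjoint_right.1 h2 hy⟩ hx hy)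

/-- Each variable is a nonzero linear form on `F × F`; its fibres are lines, parametrised by `F`. -/
theorem card_fieldValue_fiber [DecidableEq F] (i : V) (ω : F × F) :
    (Finset.univ.filter fun ω' => fieldValue e α ω' i = fieldValue e α ω i).card =
      Fintype.card F := by
  suffices h : ∃ g : F → F × F, Function.Injective g ∧
      ∀ ω', fieldValue e α ω' i = fieldValue e α ω i ↔ ∃ t, g t = ω' by
    obtain ⟨g, hg, h⟩ := h
    rw [← Finset.card_univ, ← Finset.card_image_of_injective _ hg]
    congr 1
    ext ω'
    simp [h]
  generalize fieldValue e α ω i = c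
  simp only [fieldValue]
  split_ifs
  · refine ⟨fun t => (c, t), fun s t h => (Prod.mk.inj h).2, fun ω' => ?_⟩
    exact ⟨fun h => ⟨ω'.2, Prod.ext h.symm rfl⟩, by rintro ⟨t, rfl⟩; rfl⟩
  · refine ⟨fun t => (t, c), fun s t h => (Prod.mk.inj h).1, fun ω' => ?_⟩
    exact ⟨fun h => ⟨ω'.1, Prod.ext rfl h.symm⟩, by rintro ⟨t, rfl⟩; rfl⟩
  · refine ⟨fun t => (c - α (e i) * t, t), fun s t h => (Prod.mk.inj h).2, fun ω' => ?_⟩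
    exact ⟨fun h => ⟨ω'.2, Prod.ext (by rw [← h]; simp) rfl⟩, by rintro ⟨t, rfl⟩; simp⟩

theorem entropy_fieldLaw (he : Function.Injective e)
    (h0 : ∀ k : Fin n, 2 ≤ (k : ℕ) → α k ≠ 0) (hα : Set.InjOn α {k : Fin n | 2 ≤ (k : ℕ)})
    (S : Finset V) : entropy (Fintype.card F) (fieldLaw e F α) S = (min S.card 2 : ℕ) := by
  classical
  have hF : (1 : ℝ) < Fintype.card F := by exact_mod_cast Fintype.one_lt_card
  have hlog := (Real.log_pos hF).ne'
  rcases Nat.lt_or_ge S.card 2 with hS | hS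
  · rcases S.eq_empty_or_nonempty with rfl | hne
    · simp [entropy_empty]
    · have h1 : S.card = 1 := by have := hne.card_pos; omega
      obtain ⟨i, rfl⟩ := Finset.card_eq_one.1 h1
      rw [fieldLaw_eq_map, entropy_map_uniform _ (fieldValue e α) {i} (Fintype.card F)]
      · rw [Fintype.card_prod, Nat.cast_mul, mul_div_cancel_right₀ _ (by positivity),
          div_self hlog]
        simp
      · intro ω
        simp only [Finset.mem_singleton, forall_eq]
        exact card_fieldValue_fiber i ω
  · rw [fieldLaw_eq_map, entropy_map_uniform _ (fieldValue e α) S 1]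
    · rw [Fintype.card_prod, Nat.cast_mul, Nat.cast_one, div_one, ← sq, Real.log_pow,
        mul_div_assoc, div_self hlog, mul_one, min_eq_right hS]
    · intro ω
      rw [Finset.card_eq_one]
      refine ⟨ω, ?_⟩
      ext ω'
      simp only [Finset.mem_filter, Finset.mem_univ, true_and, Finset.mem_singleton]
      exact ⟨eq_of_forall_mem_fieldValue_eq he h0 hα hS, by rintro rfl; simp⟩

/-- The claimed atoms satisfy the inversion equations: a set of size `n` has `n` subsets of size `n
- 1`, giving `n - (n - 2) = 2`; one of size `n - 1` gives 1; smaller ones give 0. -/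
theorem sum_powerset_cycle_atom {V : Type*} {n : ℕ} (hn : 3 ≤ n) {S : Finset V}
    (hS : S.card ≤ n) :
    ∑ W ∈ S.powerset,
      (if W.card = n then -((n : ℝ) - 2) else if W.card = n - 1 then 1 else 0) =
      2 - ((min (n - S.card) 2 : ℕ) : ℝ) := by
  rw [Finset.sum_powerset_apply_card fun j =>
    if j = n then -((n : ℝ) - 2) else if j = n - 1 then 1 else 0]
  have hsplit : ∀ j : ℕ, S.card.choose j • (if j = n then -((n : ℝ) - 2)
      else if j = n - 1 then 1 else 0) =
      (if j = n then (S.card.choose n : ℝ) * -((n : ℝ) - 2) else 0) +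
        (if j = n - 1 then (S.card.choose (n - 1) : ℝ) else 0) := by
    intro j
    rw [nsmul_eq_mul]
    by_cases h1 : j = n
    · subst h1
      simp [show j ≠ j - 1 by omega]
    · by_cases h2 : j = n - 1
      · subst h2
        simp [h1]
      · simp [h1, h2]
  simp only [hsplit]
  rw [Finset.sum_add_distrib, Finset.sum_ite_eq', Finset.sum_ite_eq']
  simp only [Finset.mem_range]
  rcases Nat.lt_or_ge S.card (n - 1) with h | h
  · rw [if_neg (by omega), if_neg (by omega), min_eq_right (by omega)]
    simp
  · rcases Nat.lt_or_ge S.card n with h' | h'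
    · have hc : S.card = n - 1 := by omega
      rw [if_neg (by omega), if_pos (by omega), hc, Nat.choose_self,
        show n - (n - 1) = 1 by omega]
      norm_num
    · have hc : S.card = n := by omega
      rw [if_pos (by omega), if_pos (by omega), hc, Nat.choose_self,
        Nat.choose_symm (show 1 ≤ n by omega), Nat.choose_one_right]
      simp

theorem iMeasure_fieldLaw_atom [Fintype V] [DecidableEq V] (hn : 3 ≤ n) (e : V ≃ Fin n)
    (h0 : ∀ k : Fin n, 2 ≤ (k : ℕ) → α k ≠ 0) (hα : Set.InjOn α {k : Fin n | 2 ≤ (k : ℕ)})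
    (W : Finset V) :
    iMeasure (Fintype.card F : ℝ) (fieldLaw e F α) (atom W) =
      if W.card = n then -((n : ℝ) - 2) else if W.card = n - 1 then 1 else 0 := by
  have hcard : Fintype.card V = n := by rw [Fintype.card_congr e, Fintype.card_fin]
  refine eq_of_sum_powerset_eq (f := fun W => iMeasure (Fintype.card F : ℝ) (fieldLaw e F α)
    (atom W)) (g := fun W => if W.card = n then -((n : ℝ) - 2) else
      if W.card = n - 1 then 1 else 0) (fun S => ?_) W
  have hS : S.card ≤ n := hcard ▸ S.card_le_univ
  rw [sum_powerset_iMeasure_atom, sum_powerset_cycle_atom hn hS,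
    entropy_fieldLaw e.injective h0 hα, entropy_fieldLaw e.injective h0 hα, Finset.card_univ,
    Finset.card_compl, hcard, min_eq_right (by omega : 2 ≤ n)]
  norm_num

theorem exists_coefficients (F : Type*) [Field F] [Fintype F] {n : ℕ}
    (h : n - 1 ≤ Fintype.card F) :
    ∃ α : Fin n → F, (∀ k : Fin n, 2 ≤ (k : ℕ) → α k ≠ 0) ∧
      Set.InjOn α {k : Fin n | 2 ≤ (k : ℕ)} := by
  classical
  -- Only `n - 2` coefficients are needed, and there are `card F - 1 ≥ n - 2` units. The value 0 at
  -- the indices 0 and 1 never enters the law.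
  obtain ⟨g⟩ : Nonempty (Fin (n - 2) ↪ Fˣ) := by
    apply Function.Embedding.nonempty_of_card_le
    rw [Fintype.card_fin, Fintype.card_units]
    omega
  refine ⟨fun k => if hk : 2 ≤ (k : ℕ) then g ⟨k - 2, by omega⟩ else 0, fun k hk => ?_,
    fun k hk l hl hkl => ?_⟩
  · simp only [dif_pos hk]
    exact Units.ne_zero _
  · have hk' : 2 ≤ (k : ℕ) := hk
    have hl' : 2 ≤ (l : ℕ) := hl
    simp only [dif_pos hk', dif_pos hl'] at hkl
    have := Fin.ext_iff.1 (g.injective (Units.ext hkl))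
    simp only at this
    exact Fin.ext (by omega)

end Field

/-! ### Graphs that are not paths, and the conclusion -/

theorem exists_three_neighbors {V : Type*} [Fintype V] {G : SimpleGraph V} [DecidableRel G.Adj]
    {u : V} (h : 3 ≤ G.degree u) :
    ∃ v : Fin 3 → V, Function.Injective v ∧ ∀ l, G.Adj u (v l) := by
  obtain ⟨g⟩ : Nonempty (Fin 3 ↪ G.neighborSet u) := by
    apply Function.Embedding.nonempty_of_card_le
    rwa [Fintype.card_fin, card_neighborSet_eq_degree]
  exact ⟨fun l => g l, fun _ _ h => g.injective (Subtype.ext h), fun l => (g l).2⟩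

theorem isPathGraph_of_forall_nonneg {V : Type*} [Fintype V] [DecidableEq V] {G : SimpleGraph V}
    [DecidableRel G.Adj] (hG : G.Connected) {b : ℝ} (hb : 1 < b)
    (h : ∀ (X : V → Type) (p : PMF (∀ i, X i)), FiniteEntropy p → IsMRF G p →
      0 ≤ iMeasure b p) : IsPathGraph G := by
  have hdeg : ∀ v, G.degree v ≤ 2 := by
    intro u
    by_contra! hu
    obtain ⟨v, hv, hadj⟩ := exists_three_neighbors hu
    refine not_nonneg_of_atom_neg hb one_lt_two (xorLaw u v) (W := {u, v 0, v 1, v 2}) ?_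
      (h _ _ (finiteEntropy_of_finite _) (isMRF_xorLaw hadj))
    rw [iMeasure_xorLaw_atom hv fun l => (hadj l).ne]
    norm_num
  by_cases h2 : ∀ v, G.degree v = 2
  · exfalso
    obtain ⟨n, hn, ⟨e⟩⟩ := exists_iso_cycleGraph hG h2
    -- A prime `q ≥ n` makes `ZMod q` a large enough field; the full atom then has value `-(n - 2) <
    -- 0`.
    obtain ⟨q, hq, hprime⟩ := Nat.exists_infinite_primes n
    have : Fact q.Prime := ⟨hprime⟩
    have hcard : Fintype.card (ZMod q) = q := ZMod.card q
    obtain ⟨α, h0, hα⟩ := exists_coefficients (ZMod q) (n := n) (by omega)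
    have hF : (1 : ℝ) < Fintype.card (ZMod q) := by exact_mod_cast Fintype.one_lt_card
    refine not_nonneg_of_atom_neg hb hF (fieldLaw e (ZMod q) α) (W := Finset.univ) ?_
      (h _ _ (finiteEntropy_of_finite _) (isMRF_fieldLaw hn e h0 hα))
    have := iMeasure_fieldLaw_atom hn e.toEquiv h0 hα Finset.univ
    rw [if_pos (by rw [Finset.card_univ, Fintype.card_congr e.toEquiv, Fintype.card_fin])] at this
    refine lt_of_eq_of_lt this ?_
    have : (3 : ℝ) ≤ n := by exact_mod_cast hn
    linarith
  · push Not at h2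
    obtain ⟨v, hv⟩ := h2
    -- All degrees are at most 2 and that of `v` is not 2, so `v` is an end.
    obtain ⟨e, _⟩ := exists_iso_pathGraph hG hdeg (v := v) (by have := hdeg v; omega)
    exact ⟨_, ⟨e⟩⟩

end MRF

theorem mainTheorem2 {V : Type*} [Fintype V] [DecidableEq V] (G : SimpleGraph V)
    [DecidableRel G.Adj] (hG : G.Connected) :
    -- the I-Measure (in any base) of every MRF represented by `G` is nonnegative iff `G` is a path
    (∀ b : ℝ, 1 < b →
      ((∀ (X : V → Type) (p : PMF (∀ i, X i)), MRF.FiniteEntropy p → MRF.IsMRF G p →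
          0 ≤ MRF.iMeasure b p) ↔
        MRF.IsPathGraph G)) ∧
    -- a vertex of degree at least 3: the XOR construction
    (∀ u : V, 3 ≤ G.degree u →
      (∃ v : Fin 3 → V, Function.Injective v ∧ ∀ l, G.Adj u (v l)) ∧
      ∀ v : Fin 3 → V, Function.Injective v → (∀ l, G.Adj u (v l)) →
        MRF.FiniteEntropy (MRF.xorLaw u v) ∧ MRF.IsMRF G (MRF.xorLaw u v) ∧
        MRF.iMeasure 2 (MRF.xorLaw u v) (MRF.atom {u, v 0, v 1, v 2}) = -1) ∧
    -- cycle graphs (connected, all degrees equal to 2): the finite-field construction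
    ((∀ v : V, G.degree v = 2) →
      ∃ n : ℕ, 3 ≤ n ∧ Nonempty (G ≃g SimpleGraph.cycleGraph n)) ∧
    (∀ n : ℕ, 3 ≤ n → ∀ e : G ≃g SimpleGraph.cycleGraph n,
      ∀ (F : Type) [Field F] [Fintype F], n - 1 ≤ Fintype.card F →
      (∃ α : Fin n → F, (∀ k : Fin n, 2 ≤ (k : ℕ) → α k ≠ 0) ∧
        Set.InjOn α {k : Fin n | 2 ≤ (k : ℕ)}) ∧
      ∀ α : Fin n → F, (∀ k : Fin n, 2 ≤ (k : ℕ) → α k ≠ 0) →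
        Set.InjOn α {k : Fin n | 2 ≤ (k : ℕ)} →
        MRF.FiniteEntropy (MRF.fieldLaw e F α) ∧ MRF.IsMRF G (MRF.fieldLaw e F α) ∧
        ∀ W : Finset V, W.Nonempty →
          MRF.iMeasure (Fintype.card F : ℝ) (MRF.fieldLaw e F α) (MRF.atom W) =
            if W.card = n then -((n : ℝ) - 2) else if W.card = n - 1 then 1 else 0) := by
  refine ⟨fun b hb => ⟨MRF.isPathGraph_of_forall_nonneg hG hb, ?_⟩, fun u hu => ⟨
    MRF.exists_three_neighbors hu, fun v hv hadj => ⟨MRF.finiteEntropy_of_finite _,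
      MRF.isMRF_xorLaw hadj, MRF.iMeasure_xorLaw_atom hv fun l => (hadj l).ne⟩⟩,
    MRF.exists_iso_cycleGraph hG, ?_⟩
  · rintro ⟨n, ⟨e⟩⟩ X p hp hM
    exact MRF.iMeasure_nonneg_of_pathGraph e hb hp hM
  · intro n hn e F _ _ hF
    exact ⟨MRF.exists_coefficients F hF, fun α h0 hα => ⟨MRF.finiteEntropy_of_finite _,
      MRF.isMRF_fieldLaw hn e h0 hα, fun W _ => MRF.iMeasure_fieldLaw_atom hn e.toEquiv h0 hα W⟩⟩
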